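/- **Setting.** A deep-water Stokes wave of speed $c>0$ and wavelength $\lambda>0$ is given, in the frame moving with the wave ($x$ denotes the horizontal coordinate relative to a crest), by a differentiable free surface $\eta:\mathbb R\to\mathbb R$, a velocity field $(u,v)$ and a pressure $P$ such that, with $D=\{(x,y): y<\eta(x)\}$: $u,v$ are bounded and $C^1$ in $D$, $P$ is differentiable in $D$, and $u,v,P$ are continuous on $\overline D=\{y\le\eta(x)\}$; in $D$, $$(u-c)u_x+vu_y=-P_x,\quad (u-c)v_x+vv_y=-P_y-g,\quad u_x+v_y=0,\quad u_y-v_x=0$$ with a constant $g>0$; on $y=\eta(x)$, $v=(u-c)\eta'$ and $P=P_{atm}$; $(u,v)\to(0,0)$ as $y\to-\infty$ uniformly in $x$; $u<c$ on $\overline D$; $\eta,u,v$ are $\lambda$-periodic in $x$; $\eta,u,P$ are even in $x$; and $\eta$ is strictly increasing on $[-\lambda/2,0]$ and strictly decreasing on $[0,\lambda/2]$. The stream function $\psi$ is continuous on $\overline D$ with $\psi_y=u-c$, $\psi_x=-v$ in $D$ and $\psi=0$ on $y=\eta(x)$; the velocity potential $\varphi$ is the harmonic conjugate, $\varphi_x=\psi_y$,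 $\varphi_y=-\psi_x$ in $D$, with $\varphi=0$ on the trough line $x=\lambda/2$. Put $h=\varphi+i\psi$, $q+ip=h(x,y)$, $E=\tfrac12((u-c)^2+v^2)$, and, for $p>0$, $$\mu_s(E,p)=\frac1{c\lambda}\int_0^{c\lambda}E(h^{-1}(q,p))^s\,dq .$$ Let $G=h'\circ h^{-1}$, where $h'=u-c-iv$, on $\{p>0\}$, so that $|G(q+ip)|^2=2E(h^{-1}(q,p))$ there, and extend $G$ to $\{p<0\}$ by reflection, $G(\bar w)=\overline{G(w)}$. A particle path is a solution, defined for all $t\in\mathbb R$ and with $(x(t)-ct,y(t))\in D$, of $$x'=u(x-ct,y),\qquad y'=v(x-ct,y).$$ **Theorem 4.1.** The functions $\psi$ and $\varphi$ exist, $h$ is a bijection of $D$ onto $\{q+ip:p>0\}$, and for all $t_0,x_0,y_0$ with $(x_0-ct_0,y_0)\in D$ there is a unique particle path with $(x(t_0),y(t_0))=(x_0,y_0)$. There is a function $T:\mathbb R\to\mathbb R$ (the streamline time-period) such that: 1. for every $p>0$ one has $T(p)>0$, and for every particle path through $(x_0,y_0)$ at time $t_0$ that lies on the streamline $p$, i.e.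 $\psi(x_0-ct_0,y_0)=p$, the number $T(p)$ is the unique real solution $\mathcal T$ of $$x(\mathcal T+t_0)-c\,\mathcal T=x_0-\lambda;$$ in particular the solution depends only on $p$, not on $(t_0,x_0)$; 2. for every $p>0$, $$T(p)=\int_0^{c\lambda}\frac{dq}{2E(h^{-1}(q,p))}=\frac{c\lambda}{2}\,\mu_{-1}(E,p);$$ 3. on $(0,\infty)$, $T$ is convex and non-increasing, and $\log T$ is convex; 4. $T(p)=\int_0^{c\lambda}|G(q+ip)|^{-2}\,dq$ for all $p\neq0$, and $T$ is even: $T(-p)=T(p)$ for all $p\in\mathbb R$. -/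

import Mathlib

/-- A deep-water Stokes wave, written in the frame moving with the wave: all functions depend on
`(x, y)` where `x` is the horizontal coordinate relative to the crest at `x = 0`.
`η` is the free surface, `(u, v)` the velocity field (measured in the fixed frame), `P` the pressure,
`c` the wave speed, `L` the wavelength, `g` the gravitational acceleration.
Values outside `y ≤ η x` are irrelevant. -/
structure StokesWave where
  η : ℝ → ℝ
  u : ℝ × ℝ → ℝ
  v : ℝ × ℝ → ℝ
  P : ℝ × ℝ → ℝ
  c : ℝ
  L : ℝ
  g : ℝ
  Patm : ℝ
  c_pos : 0 < c
  L_pos : 0 < L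
  g_pos : 0 < g
  /- regularity: `C¹` and bounded in the open fluid domain, continuous up to the free surface -/
  η_diff : Differentiable ℝ η
  u_contDiff : ContDiffOn ℝ 1 u {z | z.2 < η z.1}
  v_contDiff : ContDiffOn ℝ 1 v {z | z.2 < η z.1}
  P_diff : DifferentiableOn ℝ P {z | z.2 < η z.1}
  u_cont : ContinuousOn u {z | z.2 ≤ η z.1}
  v_cont : ContinuousOn v {z | z.2 ≤ η z.1}
  P_cont : ContinuousOn P {z | z.2 ≤ η z.1}
  bounded : ∃ M : ℝ, ∀ z : ℝ × ℝ, z.2 < η z.1 → |u z| ≤ M ∧ |v z| ≤ M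
  /- the Euler equations in the moving frame -/
  euler_x : ∀ x y : ℝ, y < η x →
    (u (x, y) - c) * deriv (fun s => u (s, y)) x + v (x, y) * deriv (fun s => u (x, s)) y
      = - deriv (fun s => P (s, y)) x
  euler_y : ∀ x y : ℝ, y < η x →
    (u (x, y) - c) * deriv (fun s => v (s, y)) x + v (x, y) * deriv (fun s => v (x, s)) y
      = - deriv (fun s => P (x, s)) y - g
  incompressible : ∀ x y : ℝ, y < η x →
    deriv (fun s => u (s, y)) x + deriv (fun s => v (x, s)) y = 0
  irrotational : ∀ x y : ℝ, y < η x →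
    deriv (fun s => u (x, s)) y - deriv (fun s => v (s, y)) x = 0
  /- boundary conditions on the free surface, and water at rest at great depth -/
  kinematic : ∀ x : ℝ, v (x, η x) = (u (x, η x) - c) * deriv η x
  dynamic : ∀ x : ℝ, P (x, η x) = Patm
  rest_at_depth : ∀ ε : ℝ, 0 < ε → ∃ Y : ℝ, ∀ x y : ℝ, y ≤ Y → y ≤ η x →
    |u (x, y)| < ε ∧ |v (x, y)| < ε
  /- particles move slower than the wave -/
  u_lt_c : ∀ x y : ℝ, y ≤ η x → u (x, y) < c
  /- periodicity, symmetry about the crest, strict monotonicity from trough to crest to trough -/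
  η_periodic : ∀ x : ℝ, η (x + L) = η x
  u_periodic : ∀ x y : ℝ, y ≤ η x → u (x + L, y) = u (x, y)
  v_periodic : ∀ x y : ℝ, y ≤ η x → v (x + L, y) = v (x, y)
  η_symm : ∀ x : ℝ, η (-x) = η x
  u_symm : ∀ x y : ℝ, y ≤ η x → u (-x, y) = u (x, y)
  P_symm : ∀ x y : ℝ, y ≤ η x → P (-x, y) = P (x, y)
  η_strictMono : StrictMonoOn η (Set.Icc (-(L / 2)) 0)
  η_strictAnti : StrictAntiOn η (Set.Icc 0 (L / 2))

namespace StokesWave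

/-- The fluid domain `D` (in the moving frame). -/
def domain (W : StokesWave) : Set (ℝ × ℝ) := {z | z.2 < W.η z.1}

/-- The stream function: `ψ_y = u - c`, `ψ_x = -v` in `D`, normalized by `ψ = 0` on the free surface
(up to which it is continuous). -/
structure IsStreamFunction (W : StokesWave) (ψ : ℝ × ℝ → ℝ) : Prop where
  cont : ContinuousOn ψ {z | z.2 ≤ W.η z.1}
  deriv_y : ∀ x y : ℝ, (x, y) ∈ W.domain → HasDerivAt (fun s => ψ (x, s)) (W.u (x, y) - W.c) y
  deriv_x : ∀ x y : ℝ, (x, y) ∈ W.domain → HasDerivAt (fun s => ψ (s, y)) (-W.v (x, y)) x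
  surface : ∀ x : ℝ, ψ (x, W.η x) = 0

/-- The velocity potential: the harmonic conjugate `φ_x = ψ_y`, `φ_y = -ψ_x` in `D`, normalized to
vanish on the trough line `x = L / 2`. -/
structure IsVelocityPotential (W : StokesWave) (φ ψ : ℝ × ℝ → ℝ) : Prop where
  deriv_x : ∀ x y : ℝ, (x, y) ∈ W.domain →
    HasDerivAt (fun s => φ (s, y)) (deriv (fun s => ψ (x, s)) y) x
  deriv_y : ∀ x y : ℝ, (x, y) ∈ W.domain →
    HasDerivAt (fun s => φ (x, s)) (-deriv (fun s => ψ (s, y)) x) y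
  trough : ∀ y : ℝ, (W.L / 2, y) ∈ W.domain → φ (W.L / 2, y) = 0

/-- The hodograph transform `h = φ + i ψ`, with values `q + i p`. -/
def hodograph (φ ψ : ℝ × ℝ → ℝ) (z : ℝ × ℝ) : ℂ := ⟨φ z, ψ z⟩

/-- The inverse of the hodograph transform on the fluid domain. -/
noncomputable def hodographInv (W : StokesWave) (φ ψ : ℝ × ℝ → ℝ) : ℂ → ℝ × ℝ :=
  Function.invFunOn (hodograph φ ψ) W.domain

/-- The kinetic energy density `E = ((u - c)² + v²) / 2` in the moving frame. -/
noncomputable def energy (W : StokesWave) (z : ℝ × ℝ) : ℝ :=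
  ((W.u z - W.c) ^ 2 + W.v z ^ 2) / 2

/-- The integral mean `μ_s(E, p)` of the kinetic energy along the streamline `p`. -/
noncomputable def energyMean (W : StokesWave) (φ ψ : ℝ × ℝ → ℝ) (s p : ℝ) : ℝ :=
  1 / (W.c * W.L) * ∫ q in (0 : ℝ)..(W.c * W.L), W.energy (W.hodographInv φ ψ ⟨q, p⟩) ^ s

/-- The complex velocity `h' = (u - c) - i v` at a point of the fluid. -/
def complexVelocity (W : StokesWave) (z : ℝ × ℝ) : ℂ := ⟨W.u z - W.c, -W.v z⟩

open Classical in
/-- The complex velocity `h' ∘ h⁻¹` in the `(q, p)`-plane. The transform `h⁻¹` lives on `p > 0` only;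
`h' ∘ h⁻¹` is continued to `p < 0` by reflection, `G (conj w) = conj (G w)`. -/
noncomputable def reflectedVelocity (W : StokesWave) (φ ψ : ℝ × ℝ → ℝ) (w : ℂ) : ℂ :=
  if 0 < w.im then W.complexVelocity (W.hodographInv φ ψ w)
  else starRingEnd ℂ (W.complexVelocity (W.hodographInv φ ψ (starRingEnd ℂ w)))

/-- `X` is the path in the fixed frame of a fluid particle, for all times:
`x' = u(x - ct, y)`, `y' = v(x - ct, y)`. -/
def IsParticlePath (W : StokesWave) (X : ℝ → ℝ × ℝ) : Prop :=
  ∀ t : ℝ, ((X t).1 - W.c * t, (X t).2) ∈ W.domain ∧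
    HasDerivAt X
      (W.u ((X t).1 - W.c * t, (X t).2), W.v ((X t).1 - W.c * t, (X t).2)) t

end StokesWave

/-! In the moving frame a particle satisfies x' = u - c, y' = v, so along its path ψ' = 0 and φ' =
(u - c)² + v² = 2E. In hodograph coordinates the motion is thus horizontal with speed 2E, and the
integral of dq/(2E) along the streamline is a clock that runs at unit rate. Since φ drops by cλ when
x grows by λ, the particle has moved by -λ exactly when q has grown by cλ; this gives T(p) as the
integral of 1/(2E) over one period. Inverting the clock also yields global existence and uniqueness
of particle paths (`exists_isParticlePath`, `IsParticlePath.ext`).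

Because 2E = |h'|², T is the squared L² norm over a period of F = 1/(h' ∘ h⁻¹). This F is
holomorphic on the upper half-plane, cλ-periodic, and bounded near i∞, where h' tends to -c. Hence F
is a power series in exp(2πiw/(cλ)), and Parseval writes T(p) as a sum of terms a_n exp(-4πnp/(cλ))
with a_n ≥ 0 (`exists_hasSum_exp_passageTime`). Convexity, monotonicity and log-convexity all follow
termwise.

What remains is to construct ψ and φ and to show that h is a conformal bijection: u < c makes ψ
strictly monotone on verticals and φ strictly monotone on streamlines. -/

/-! ### Parseval on horizontal lines and exponential series. -/

/-- Parseval: absolute summability gives convergence in the continuous functions on the circle,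
hence in L², where the exponentials are orthonormal. -/
theorem hasSum_sq_intervalIntegral_of_hasSum_exp {Λ : ℝ} (hΛ : 0 < Λ) {c : ℕ → ℂ}
    (hc : Summable fun n => ‖c n‖) {f : ℝ → ℂ}
    (hf : ∀ x : ℝ, HasSum (fun n : ℕ => c n * Complex.exp (2 * Real.pi * Complex.I * n * x / Λ))
      (f x)) :
    HasSum (fun n => Λ * ‖c n‖ ^ 2) (∫ x in (0 : ℝ)..Λ, ‖f x‖ ^ 2) := by
  have : Fact (0 < Λ) := ⟨hΛ⟩
  have hsum : Summable fun n : ℕ => c n • (fourier (n : ℤ) : C(AddCircle Λ, ℂ)) := by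
    refine Summable.of_norm ?_
    simpa [norm_smul, fourier_norm] using hc
  obtain ⟨g, hg⟩ := hsum
  have hgf : ∀ x : ℝ, g (x : AddCircle Λ) = f x := by
    intro x
    have h1 := hg.mapL (ContinuousMap.evalCLM ℂ (x : AddCircle Λ))
    refine h1.unique ?_
    convert hf x using 2 with n
    have h0 : (fourier (n : ℤ) : C(AddCircle Λ, ℂ)) x
        = Complex.exp (2 * Real.pi * Complex.I * n * x / Λ) := by
      rw [fourier_coe_apply]; simp
    rw [← h0]; rfl
  have h2 := hg.mapL (ContinuousMap.toLp (E := ℂ) 2 AddCircle.haarAddCircle ℂ)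
  have h3 : HasSum (fun n => ‖c n‖ ^ 2)
      (‖ContinuousMap.toLp (E := ℂ) 2 (AddCircle.haarAddCircle (T := Λ)) ℂ g‖ ^ 2) := by
    have h4 := ((continuous_norm.pow 2).tendsto _).comp h2
    refine h4.congr fun s => ?_
    have ho : Orthonormal ℂ fun n : ℕ => fourierLp (T := Λ) 2 (n : ℤ) :=
      orthonormal_fourier.comp _ Nat.cast_injective
    have h5 := ho.inner_sum c c s
    rw [inner_self_eq_norm_sq_to_K] at h5
    have h6 : ((‖∑ i ∈ s, c i • fourierLp (T := Λ) 2 (i : ℤ)‖ ^ 2 : ℝ) : ℂ)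
        = ((∑ i ∈ s, ‖c i‖ ^ 2 : ℝ) : ℂ) := by
      push_cast
      refine Eq.trans (by simp) (h5.trans (Finset.sum_congr rfl fun i _ => ?_))
      rw [mul_comm, Complex.mul_conj, Complex.normSq_eq_norm_sq]
      push_cast; rfl
    simpa [Function.comp_def] using Complex.ofReal_injective h6
  have h7 : ‖ContinuousMap.toLp (E := ℂ) 2 (AddCircle.haarAddCircle (T := Λ)) ℂ g‖ ^ 2
      = ∫ t : AddCircle Λ, ‖g t‖ ^ 2 ∂AddCircle.haarAddCircle := by
    have h8 := inner_self_eq_norm_sq_to_K (𝕜 := ℂ)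
      (ContinuousMap.toLp (E := ℂ) 2 (AddCircle.haarAddCircle (T := Λ)) ℂ g)
    rw [MeasureTheory.L2.inner_def] at h8
    have h9 : ∫ t : AddCircle Λ, inner ℂ
        ((ContinuousMap.toLp (E := ℂ) 2 (AddCircle.haarAddCircle (T := Λ)) ℂ g) t)
        ((ContinuousMap.toLp (E := ℂ) 2 (AddCircle.haarAddCircle (T := Λ)) ℂ g) t)
          ∂AddCircle.haarAddCircle
        = ∫ t : AddCircle Λ, ((‖g t‖ ^ 2 : ℝ) : ℂ) ∂AddCircle.haarAddCircle := by
      refine MeasureTheory.integral_congr_ae ?_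
      filter_upwards [ContinuousMap.coeFn_toLp (𝕜 := ℂ) (p := 2)
        (AddCircle.haarAddCircle (T := Λ)) g] with t ht
      rw [ht, inner_self_eq_norm_sq_to_K]
      push_cast; rfl
    rw [h9, integral_complex_ofReal] at h8
    refine Complex.ofReal_injective (Eq.trans ?_ h8.symm)
    push_cast; rfl
  have h11 : ∫ x in (0 : ℝ)..Λ, ‖f x‖ ^ 2
      = Λ * ∫ t : AddCircle Λ, ‖g t‖ ^ 2 ∂AddCircle.haarAddCircle := by
    rw [AddCircle.integral_haarAddCircle, smul_eq_mul, mul_inv_cancel_left₀ hΛ.ne',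
      ← AddCircle.intervalIntegral_preimage Λ 0 (fun t => ‖g t‖ ^ 2), zero_add]
    simp_rw [hgf]
  rw [h11, ← h7]
  exact h3.mul_left Λ

open Function.Periodic in
/-- Squared `L²` means over a period of a periodic holomorphic function on the upper half-plane,
bounded near `i∞`, are exponential series with non-negative coefficients. -/
theorem exists_hasSum_exp_of_periodic_holomorphic {Λ : ℝ} (hΛ : 0 < Λ) {F : ℂ → ℂ}
    (hd : DifferentiableOn ℂ F {w | 0 < w.im}) (hp : Function.Periodic F Λ)
    (hb : (Filter.comap Complex.im Filter.atTop).BoundedAtFilter F) :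
    ∃ a : ℕ → ℝ, (∀ n, 0 ≤ a n) ∧ ∀ p : ℝ, 0 < p →
      HasSum (fun n : ℕ => a n * Real.exp (-(4 * Real.pi * n / Λ) * p))
        (∫ q in (0 : ℝ)..Λ, ‖F ⟨q, p⟩‖ ^ 2) := by
  have hopen : IsOpen {w : ℂ | 0 < w.im} := isOpen_lt continuous_const Complex.continuous_im
  have hda : ∀ w : ℂ, 0 < w.im → DifferentiableAt ℂ F w := fun w hw =>
    hd.differentiableAt (hopen.mem_nhds hw)
  -- F factors through exp(2πiw/Λ); boundedness at i∞ removes the singularity of the resulting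
  -- function at 0, so it has a Taylor series on the unit disc.
  have hk : DifferentiableOn ℂ (cuspFunction Λ F) (Metric.ball 0 1) := by
    intro z hz
    apply DifferentiableAt.differentiableWithinAt
    by_cases hz0 : z = 0
    · subst hz0
      refine differentiableAt_cuspFunction_zero hΛ hp ?_ hb
      filter_upwards [Filter.preimage_mem_comap (Filter.Ioi_mem_atTop 0)] with w hw
      exact hda w hw
    · rw [← qParam_right_inv hΛ.ne' hz0]
      refine differentiableAt_cuspFunction hΛ.ne' hp (hda _ ?_)
      rw [im_invQParam]
      have h1 : Real.log ‖z‖ < 0 := Real.log_neg (norm_pos_iff.2 hz0) (by simpa using hz)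
      have h2 : -Λ / (2 * Real.pi) < 0 := div_neg_of_neg_of_pos (by linarith) (by positivity)
      exact mul_pos_of_neg_of_neg h2 h1
  set b : ℕ → ℂ := fun n => (n.factorial : ℂ)⁻¹ * iteratedDeriv n (cuspFunction Λ F) 0 with hbdef
  have hser : ∀ w : ℂ, 0 < w.im → HasSum (fun n => b n * qParam Λ w ^ n) (F w) := by
    intro w hw
    have h1 := Complex.hasSum_taylorSeries_on_ball hk
      (z := qParam Λ w) (by simpa using norm_qParam_lt_one hΛ hw)
    rw [eq_cuspFunction hΛ.ne' hp] at h1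
    have h2 : (fun n => b n * qParam Λ w ^ n) = fun n : ℕ => (n.factorial : ℂ)⁻¹ •
        (qParam Λ w - 0) ^ n • iteratedDeriv n (cuspFunction Λ F) 0 := by
      funext n
      simp only [hbdef, sub_zero, smul_eq_mul]
      ring
    rw [h2]
    exact h1
  clear_value b
  refine ⟨fun n => Λ * ‖b n‖ ^ 2, fun n => by positivity, fun p hpos => ?_⟩
  -- The modulus of exp(2πiw/Λ) on Im w = p. For fixed p the Fourier coefficients are b n * r ^ n,
  -- and squaring doubles the decay rate to 4πn/Λ.
  set r : ℝ := Real.exp (-2 * Real.pi * p / Λ) with hr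
  have hq : ∀ q : ℝ, ∀ n : ℕ, b n * qParam Λ ⟨q, p⟩ ^ n
      = (b n * (r : ℂ) ^ n) * Complex.exp (2 * Real.pi * Complex.I * n * q / Λ) := by
    intro q n
    rw [mul_assoc]
    refine congrArg (b n * ·) ?_
    rw [hr]
    unfold qParam
    rw [← Complex.exp_nat_mul, Complex.ofReal_exp, ← Complex.exp_nat_mul,
      ← Complex.exp_add]
    congr 1
    rw [Complex.mk_eq_add_mul_I]
    push_cast
    linear_combination (2 * (n:ℂ) * Real.pi * p / Λ) * Complex.I_sq
  have hr0 : 0 < r := Real.exp_pos _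
  have hc : Summable fun n => ‖b n * (r : ℂ) ^ n‖ := by
    have h1 := summable_norm_iff.2 (hser ⟨0, p⟩ hpos).summable
    convert h1 using 2 with n
    rw [hq, norm_mul _ (Complex.exp _)]
    simp
  have h2 := hasSum_sq_intervalIntegral_of_hasSum_exp hΛ hc (f := fun q => F ⟨q, p⟩) fun q => by
    simpa only [hq] using hser ⟨q, p⟩ hpos
  convert h2 using 2 with n
  rw [norm_mul, mul_pow, norm_pow, Complex.norm_real, Real.norm_of_nonneg hr0.le, mul_assoc,
    ← pow_mul, hr, ← Real.exp_nat_mul]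
  congr 3
  push_cast
  ring

/-- A positive exponential series with non-negative coefficients is log-convex. -/
theorem convexOn_log_of_hasSum_exp {a b : ℕ → ℝ} (ha : ∀ n, 0 ≤ a n) {T : ℝ → ℝ}
    (hT : ∀ p, 0 < p → HasSum (fun n => a n * Real.exp (-b n * p)) (T p))
    (hpos : ∀ p, 0 < p → 0 < T p) :
    ConvexOn ℝ (Set.Ioi 0) fun p => Real.log (T p) := by
  refine ⟨convex_Ioi 0, fun x hx y hy s t hs ht hst => ?_⟩
  have hx : 0 < x := hx
  have hy : 0 < y := hy
  have hz : 0 < s • x + t • y := (convex_Ioi (0 : ℝ)) hx hy hs ht hst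
  have hTx := hpos x hx
  have hTy := hpos y hy
  set A := Real.log (T x) with hA
  set B := Real.log (T y) with hB
  -- Normalize T(x) and T(y) to 1 by the factors exp(-A), exp(-B). Convexity of exp then bounds each
  -- term, and the sum of the bounds is s + t = 1; this is Hölder's inequality.
  have h1 : HasSum (fun n => a n * Real.exp (-b n * (s • x + t • y)) * Real.exp (-(s * A + t * B)))
    (T (s • x + t • y) * Real.exp (-(s * A + t * B))) := (hT _ hz).mul_right _
  have h2 : HasSum (fun n => s * (a n * Real.exp (-b n * x) * Real.exp (-A))
      + t * (a n * Real.exp (-b n * y) * Real.exp (-B)))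
      (s * (T x * Real.exp (-A)) + t * (T y * Real.exp (-B))) :=
    (((hT x hx).mul_right _).mul_left s).add (((hT y hy).mul_right _).mul_left t)
  have h3 := hasSum_le (fun n => ?_) h1 h2
  · rw [Real.exp_neg A, Real.exp_neg B, hA, hB, Real.exp_log hTx, Real.exp_log hTy,
      mul_inv_cancel₀ hTx.ne', mul_inv_cancel₀ hTy.ne', ← hA, ← hB, mul_one, mul_one, hst,
      Real.exp_neg, ← div_eq_mul_inv, div_le_one (Real.exp_pos _)] at h3
    exact (Real.log_le_iff_le_exp (hpos _ hz)).2 h3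
  · have h4 := convexOn_exp.2 (Set.mem_univ (-b n * x - A)) (Set.mem_univ (-b n * y - B)) hs ht hst
    simp only [smul_eq_mul] at h4 ⊢
    rw [mul_assoc, ← Real.exp_add, mul_assoc, mul_assoc, ← Real.exp_add, ← Real.exp_add]
    calc _ = a n * Real.exp (s * (-b n * x - A) + t * (-b n * y - B)) := by ring_nf
      _ ≤ a n * (s * Real.exp (-b n * x - A) + t * Real.exp (-b n * y - B)) :=
        mul_le_mul_of_nonneg_left h4 (ha n)
      _ = _ := by rw [sub_eq_add_neg, sub_eq_add_neg]; ring

theorem convexOn_of_hasSum_exp {a b : ℕ → ℝ} (ha : ∀ n, 0 ≤ a n) {T : ℝ → ℝ}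
    (hT : ∀ p, 0 < p → HasSum (fun n => a n * Real.exp (-b n * p)) (T p)) :
    ConvexOn ℝ (Set.Ioi 0) T := by
  refine ⟨convex_Ioi 0, fun x hx y hy s t hs ht hst => ?_⟩
  have h1 := hT _ ((convex_Ioi (0 : ℝ)) hx hy hs ht hst)
  refine hasSum_le (fun n => ?_) h1 (((hT x hx).mul_left s).add ((hT y hy).mul_left t))
  have h4 := convexOn_exp.2 (Set.mem_univ (-b n * x)) (Set.mem_univ (-b n * y)) hs ht hst
  simp only [smul_eq_mul] at h4 ⊢
  calc _ = a n * Real.exp (s * (-b n * x) + t * (-b n * y)) := by ring_nf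
    _ ≤ _ := mul_le_mul_of_nonneg_left h4 (ha n)
    _ = _ := by ring

theorem antitoneOn_of_hasSum_exp {a b : ℕ → ℝ} (ha : ∀ n, 0 ≤ a n) (hb : ∀ n, 0 ≤ b n)
    {T : ℝ → ℝ} (hT : ∀ p, 0 < p → HasSum (fun n => a n * Real.exp (-b n * p)) (T p)) :
    AntitoneOn T (Set.Ioi 0) := by
  intro x hx y hy hxy
  refine hasSum_le (fun n => mul_le_mul_of_nonneg_left (Real.exp_le_exp.2 ?_) (ha n)) (hT y hy)
    (hT x hx)
  nlinarith [hb n]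

/-! ### Line integrals of closed forms below a graph. -/

section

open Set Filter Topology

/-- Strictness is what the inverse function theorem for the streamlines will need. -/
theorem hasStrictFDerivAt_of_continuousOn_partials {s : Set (ℝ × ℝ)} (hs : IsOpen s)
    {f a b : ℝ × ℝ → ℝ} (ha : ContinuousOn a s) (hb : ContinuousOn b s)
    (hfx : ∀ x y, (x, y) ∈ s → HasDerivAt (fun t => f (t, y)) (a (x, y)) x)
    (hfy : ∀ x y, (x, y) ∈ s → HasDerivAt (fun t => f (x, t)) (b (x, y)) y)
    {z : ℝ × ℝ} (hz : z ∈ s) :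
    HasStrictFDerivAt f
      (a z • ContinuousLinearMap.fst ℝ ℝ ℝ + b z • ContinuousLinearMap.snd ℝ ℝ ℝ) z := by
  have hzs := hs.mem_nhds hz
  have h := hasStrictFDerivAt_uncurry_coprod (𝕜 := ℝ) (u := z) (f := fun x y => f (x, y))
    (f₁ := fun x y => ContinuousLinearMap.toSpanSingleton ℝ (a (x, y)))
    (f₂ := fun x y => ContinuousLinearMap.toSpanSingleton ℝ (b (x, y)))
    (by filter_upwards [hzs] with v hv using (hfx v.1 v.2 hv).hasFDerivAt)
    (by filter_upwards [hzs] with v hv using (hfy v.1 v.2 hv).hasFDerivAt)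
    (((ContinuousLinearMap.toSpanSingletonCLE (𝕜 := ℝ) (E := ℝ)).continuous.continuousAt).comp
      (ha.continuousAt hzs))
    (((ContinuousLinearMap.toSpanSingletonCLE (𝕜 := ℝ) (E := ℝ)).continuous.continuousAt).comp
      (hb.continuousAt hzs))
  have h2 : a z • ContinuousLinearMap.fst ℝ ℝ ℝ + b z • ContinuousLinearMap.snd ℝ ℝ ℝ
      = (ContinuousLinearMap.toSpanSingleton ℝ (a z)).coprod
        (ContinuousLinearMap.toSpanSingleton ℝ (b z)) := by
    ext <;> simp
  rw [h2]
  exact h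

/-- A function on the closed region below a graph, extended constantly above the graph. -/
noncomputable def extendUp (η : ℝ → ℝ) (f : ℝ × ℝ → ℝ) (z : ℝ × ℝ) : ℝ :=
  f (z.1, min z.2 (η z.1))

theorem extendUp_of_le {η : ℝ → ℝ} (f : ℝ × ℝ → ℝ) {x y : ℝ} (h : y ≤ η x) :
    extendUp η f (x, y) = f (x, y) := by
  simp [extendUp, h]

theorem continuous_extendUp {η : ℝ → ℝ} (hη : Continuous η) {f : ℝ × ℝ → ℝ}
    (hf : ContinuousOn f {z | z.2 ≤ η z.1}) : Continuous (extendUp η f) :=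
  hf.comp_continuous (by fun_prop) fun z => by simp

/-- The line integral of `a dx + b dy` from `(x₀, Y₀)` along a horizontal and a vertical segment. -/
noncomputable def hookIntegral (η : ℝ → ℝ) (a b : ℝ × ℝ → ℝ) (x₀ Y₀ : ℝ) (z : ℝ × ℝ) : ℝ :=
  (∫ s in x₀..z.1, extendUp η a (s, Y₀)) + ∫ s in Y₀..z.2, extendUp η b (z.1, s)

section hookIntegral

variable {η : ℝ → ℝ} {a b : ℝ × ℝ → ℝ} {x₀ Y₀ : ℝ}

theorem isOpen_below_graph (hη : Continuous η) : IsOpen {z : ℝ × ℝ | z.2 < η z.1} :=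
  isOpen_lt continuous_snd (hη.comp continuous_fst)

theorem continuous_hookIntegral (hη : Continuous η) (ha : ContinuousOn a {z | z.2 ≤ η z.1})
    (hb : ContinuousOn b {z | z.2 ≤ η z.1}) : Continuous (hookIntegral η a b x₀ Y₀) := by
  have hA := continuous_extendUp hη ha
  have hB := continuous_extendUp hη hb
  refine Continuous.add ?_ ?_
  · exact intervalIntegral.continuous_parametric_intervalIntegral_of_continuous
      (f := fun (_ : ℝ × ℝ) s => extendUp η a (s, Y₀)) (by fun_prop) continuous_fst
  · exact intervalIntegral.continuous_parametric_intervalIntegral_of_continuous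
      (f := fun (z : ℝ × ℝ) s => extendUp η b (z.1, s)) (by fun_prop) continuous_snd

theorem hasDerivAt_hookIntegral_snd (hη : Continuous η) (hb : ContinuousOn b {z | z.2 ≤ η z.1})
    {x y : ℝ} (hxy : y < η x) :
    HasDerivAt (fun t => hookIntegral η a b x₀ Y₀ (x, t)) (b (x, y)) y := by
  have hB := continuous_extendUp hη hb
  have h := (Continuous.integral_hasStrictDerivAt (f := fun s => extendUp η b (x, s))
    (by fun_prop) Y₀ y).hasDerivAt
  rw [extendUp_of_le b hxy.le] at h
  exact h.const_add (∫ s in x₀..x, extendUp η a (s, Y₀))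

theorem hasDerivAt_fst_of_contDiffOn {s : Set (ℝ × ℝ)} (hs : IsOpen s) {f : ℝ × ℝ → ℝ}
    (hf : ContDiffOn ℝ 1 f s) {x y : ℝ} (h : (x, y) ∈ s) :
    HasDerivAt (fun t => f (t, y)) (fderiv ℝ f (x, y) (1, 0)) x := by
  have h1 := (hf.differentiableOn one_ne_zero).differentiableAt (hs.mem_nhds h)
  exact h1.hasFDerivAt.comp_hasDerivAt x ((hasDerivAt_id x).prodMk (hasDerivAt_const x y))

theorem hasDerivAt_snd_of_contDiffOn {s : Set (ℝ × ℝ)} (hs : IsOpen s) {f : ℝ × ℝ → ℝ}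
    (hf : ContDiffOn ℝ 1 f s) {x y : ℝ} (h : (x, y) ∈ s) :
    HasDerivAt (fun t => f (x, t)) (fderiv ℝ f (x, y) (0, 1)) y := by
  have h1 := (hf.differentiableOn one_ne_zero).differentiableAt (hs.mem_nhds h)
  exact h1.hasFDerivAt.comp_hasDerivAt y ((hasDerivAt_const y x).prodMk (hasDerivAt_id y))

/-- Differentiating the vertical leg under the integral gives ∫ b_x = ∫ a_y = a(x, y) - a(x, Y₀),
and the last term cancels the derivative of the horizontal leg. -/
theorem hasDerivAt_hookIntegral_fst (hη : Continuous η) (ha : ContinuousOn a {z | z.2 ≤ η z.1})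
    (hb : ContinuousOn b {z | z.2 ≤ η z.1}) (ha' : ContDiffOn ℝ 1 a {z | z.2 < η z.1})
    (hb' : ContDiffOn ℝ 1 b {z | z.2 < η z.1})
    (hab : ∀ x y, y < η x → deriv (fun t => a (x, t)) y = deriv (fun t => b (t, y)) x)
    (hY : ∀ x, Y₀ < η x) {x y : ℝ} (hxy : y < η x) :
    HasDerivAt (fun t => hookIntegral η a b x₀ Y₀ (t, y)) (a (x, y)) x := by
  have hA := continuous_extendUp hη ha
  have hB := continuous_extendUp hη hb
  have hD := isOpen_below_graph hη
  have h1 : HasDerivAt (fun t => ∫ s in x₀..t, extendUp η a (s, Y₀)) (a (x, Y₀)) x := by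
    have h := (Continuous.integral_hasStrictDerivAt (f := fun s => extendUp η a (s, Y₀))
      (by fun_prop) x₀ x).hasDerivAt
    rwa [extendUp_of_le a (hY x).le] at h
  -- Near x the whole vertical leg stays below the graph, so b_x is bounded on a compact rectangle
  -- and dominates the difference quotients.
  obtain ⟨δ, hδ, hball⟩ : ∃ δ > 0, Metric.closedBall x δ ⊆ {t | max Y₀ y < η t} :=
    Metric.nhds_basis_closedBall.mem_iff.1
      ((isOpen_lt continuous_const hη).mem_nhds (max_lt (hY x) hxy))
  have hmem : ∀ t ∈ Metric.closedBall x δ, ∀ s ∈ uIcc Y₀ y, s < η t := fun t ht s hs =>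
    lt_of_le_of_lt hs.2 (hball ht)
  have hK : IsCompact (Metric.closedBall x δ ×ˢ uIcc Y₀ y) :=
    (isCompact_closedBall x δ).prod isCompact_uIcc
  have hbc : ContinuousOn (fun z => fderiv ℝ b z (1, 0)) {z : ℝ × ℝ | z.2 < η z.1} :=
    (hb'.continuousOn_fderiv_of_isOpen hD le_rfl).clm_apply continuousOn_const
  have hac : ContinuousOn (fun z => fderiv ℝ a z (0, 1)) {z : ℝ × ℝ | z.2 < η z.1} :=
    (ha'.continuousOn_fderiv_of_isOpen hD le_rfl).clm_apply continuousOn_const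
  obtain ⟨C, hC⟩ := hK.exists_bound_of_continuousOn
    (hbc.mono fun z hz => hmem z.1 hz.1 z.2 hz.2)
  have hxb : x ∈ Metric.closedBall x δ := Metric.mem_closedBall_self hδ.le
  have hcont : ContinuousOn (fun s => fderiv ℝ b (x, s) (1, 0)) (uIcc Y₀ y) :=
    hbc.comp (by fun_prop) fun s hs => hmem x hxb s hs
  have h2 := (intervalIntegral.hasDerivAt_integral_of_dominated_loc_of_deriv_le
    (μ := MeasureTheory.volume) (a := Y₀) (b := y) (bound := fun _ => C)
    (F := fun t s => extendUp η b (t, s)) (F' := fun t s => fderiv ℝ b (t, s) (1, 0)) (x₀ := x)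
    (Metric.ball_mem_nhds x hδ)
    (Eventually.of_forall fun t => (Continuous.aestronglyMeasurable (by fun_prop)))
    (Continuous.intervalIntegrable (by fun_prop) _ _)
    ((hcont.intervalIntegrable (μ := MeasureTheory.volume)).def'.aestronglyMeasurable)
    (Eventually.of_forall fun s hs t ht =>
      hC (t, s) ⟨Metric.ball_subset_closedBall ht, uIoc_subset_uIcc hs⟩)
    intervalIntegrable_const
    (Eventually.of_forall fun s hs t ht => by
      have hts := hmem t (Metric.ball_subset_closedBall ht) s (uIoc_subset_uIcc hs)
      refine (hasDerivAt_fst_of_contDiffOn hD hb' hts).congr_of_eventuallyEq ?_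
      filter_upwards [(isOpen_lt continuous_const hη).mem_nhds hts] with r hr
      exact extendUp_of_le b (le_of_lt hr))).2
  have h3 : ∫ s in Y₀..y, fderiv ℝ b (x, s) (1, 0) = a (x, y) - a (x, Y₀) := by
    have h4 : ∀ s ∈ uIcc Y₀ y, fderiv ℝ b (x, s) (1, 0) = fderiv ℝ a (x, s) (0, 1) := by
      intro s hs
      have := hab x s (hmem x hxb s hs)
      rw [(hasDerivAt_fst_of_contDiffOn hD hb' (hmem x hxb s hs)).deriv,
        (hasDerivAt_snd_of_contDiffOn hD ha' (hmem x hxb s hs)).deriv] at this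
      exact this.symm
    rw [intervalIntegral.integral_congr h4]
    refine intervalIntegral.integral_eq_sub_of_hasDerivAt
      (f := fun s => a (x, s)) (fun s hs => hasDerivAt_snd_of_contDiffOn hD ha' (hmem x hxb s hs))
      (ContinuousOn.intervalIntegrable ?_)
    exact hac.comp (by fun_prop) fun s hs => hmem x hxb s hs
  rw [h3] at h2
  have h5 := h1.add h2
  rw [add_sub_cancel] at h5
  exact h5

/-- A function whose gradient `(a, b)` is tangentially trivial along the graph is constant on it. -/
theorem const_on_graph {Φ : ℝ × ℝ → ℝ} (hη : Continuous η) {η' : ℝ → ℝ}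
    (hη' : ∀ x, HasDerivAt η (η' x) x) (hη'c : Continuous η') (hΦ : Continuous Φ)
    (ha : ContinuousOn a {z | z.2 ≤ η z.1}) (hb : ContinuousOn b {z | z.2 ≤ η z.1})
    (hx : ∀ x y, y < η x → HasDerivAt (fun t => Φ (t, y)) (a (x, y)) x)
    (hy : ∀ x y, y < η x → HasDerivAt (fun t => Φ (x, t)) (b (x, y)) y)
    (hs : ∀ x, a (x, η x) + b (x, η x) * η' x = 0) (x₁ x₂ : ℝ) :
    Φ (x₁, η x₁) = Φ (x₂, η x₂) := by
  have hA := continuous_extendUp hη ha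
  have hB := continuous_extendUp hη hb
  have hD := isOpen_below_graph hη
  have hsub : {z : ℝ × ℝ | z.2 < η z.1} ⊆ {z | z.2 ≤ η z.1} := fun _ hz => le_of_lt (α := ℝ) hz
  have hI : Continuous fun ε : ℝ => ∫ x in x₁..x₂, (extendUp η a (x, η x - ε)
      + extendUp η b (x, η x - ε) * η' x) :=
    intervalIntegral.continuous_parametric_intervalIntegral_of_continuous
      (f := fun ε x => extendUp η a (x, η x - ε) + extendUp η b (x, η x - ε) * η' x)
      (by fun_prop) continuous_const
  have hJ : Continuous fun ε : ℝ => Φ (x₂, η x₂ - ε) - Φ (x₁, η x₁ - ε) := by fun_prop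
  -- Φ is differentiable only strictly below the graph: integrate along the graph lowered by ε, then
  -- let ε tend to 0.
  have heq : ∀ ε : ℝ, 0 < ε → Φ (x₂, η x₂ - ε) - Φ (x₁, η x₁ - ε) = ∫ x in x₁..x₂,
      (extendUp η a (x, η x - ε) + extendUp η b (x, η x - ε) * η' x) := by
    intro ε hε
    refine (intervalIntegral.integral_eq_sub_of_hasDerivAt (f := fun x => Φ (x, η x - ε))
      (fun x _ => ?_) (Continuous.intervalIntegrable (by fun_prop) _ _)).symm
    have hlt : η x - ε < η x := by linarith
    have h1 := (hasStrictFDerivAt_of_continuousOn_partials hD (ha.mono hsub) (hb.mono hsub)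
      hx hy (z := (x, η x - ε)) hlt).hasFDerivAt.comp_hasDerivAt x
        ((hasDerivAt_id x).prodMk ((hη' x).sub_const ε))
    rw [extendUp_of_le a hlt.le, extendUp_of_le b hlt.le]
    simpa [Function.comp_def] using h1
  have h0 : (0 : ℝ) ∈ closure (Ioi 0) := by simp
  have h1 := (EqOn.closure (s := Ioi (0 : ℝ)) (fun ε hε => heq ε hε) hJ hI) h0
  simp only [sub_zero] at h1
  have h2 : ∀ x, extendUp η a (x, η x) + extendUp η b (x, η x) * η' x = 0 := fun x => by
    rw [extendUp_of_le a le_rfl, extendUp_of_le b le_rfl, hs x]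
  simp only [h2, intervalIntegral.integral_zero] at h1
  linarith

end hookIntegral

/-! ### Existence of the stream function and the velocity potential. -/

namespace StokesWave

variable (W : StokesWave)

theorem continuous_η : Continuous W.η := W.η_diff.continuous

theorem isOpen_domain : IsOpen W.domain := isOpen_below_graph W.continuous_η

theorem mem_domain {x y : ℝ} : (x, y) ∈ W.domain ↔ y < W.η x := Iff.rfl

theorem domain_subset : W.domain ⊆ {z | z.2 ≤ W.η z.1} := fun _ hz => le_of_lt (α := ℝ) hz

theorem exists_lt_η : ∃ m, ∀ x, m < W.η x := by
  obtain ⟨m, hm⟩ := (Function.Periodic.isBounded_of_continuous (f := W.η) W.η_periodic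
    W.L_pos.ne' W.continuous_η).bddBelow
  exact ⟨m - 1, fun x => by linarith [hm (mem_range_self x)]⟩

theorem exists_η_le : ∃ m, ∀ x, W.η x ≤ m := by
  obtain ⟨m, hm⟩ := (Function.Periodic.isBounded_of_continuous (f := W.η) W.η_periodic
    W.L_pos.ne' W.continuous_η).bddAbove
  exact ⟨m, fun x => hm (mem_range_self x)⟩

/-- The kinematic condition gives η' = v / (u - c) on the surface, so a merely differentiable η is
C¹. -/
theorem continuous_deriv_η : Continuous (deriv W.η) := by
  have h : deriv W.η = fun x => extendUp W.η W.v (x, W.η x) / (extendUp W.η W.u (x, W.η x) - W.c) := by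
    funext x
    have h1 : W.u (x, W.η x) - W.c ≠ 0 := (sub_neg.2 (W.u_lt_c x _ le_rfl)).ne
    rw [extendUp_of_le W.v le_rfl, extendUp_of_le W.u le_rfl, W.kinematic x,
      mul_div_cancel_left₀ _ h1]
  have hη := W.continuous_η
  have hu := continuous_extendUp hη W.u_cont
  have hv := continuous_extendUp hη W.v_cont
  rw [h]
  refine Continuous.div (by fun_prop) (by fun_prop) fun x => ?_
  rw [extendUp_of_le W.u le_rfl]
  exact (sub_neg.2 (W.u_lt_c x _ le_rfl)).ne

/-- Since v_y = -u_x is odd in x, v(-x, y) + v(x, y) does not depend on y, and it tends to 0 at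
great depth. -/
theorem v_neg {x y : ℝ} (hxy : y < W.η x) : W.v (-x, y) = -W.v (x, y) := by
  have hd : ∀ x y, y < W.η x →
      HasDerivAt (fun t => W.v (x, t)) (-deriv (fun s => W.u (s, y)) x) y := fun x y h => by
    have h1 := hasDerivAt_snd_of_contDiffOn W.isOpen_domain W.v_contDiff h
    have h2 := W.incompressible x y h
    rw [h1.deriv] at h2
    convert h1 using 1
    linarith
  have hk : ∀ t ∈ Iio (W.η x), HasDerivAt (fun t => W.v (-x, t) + W.v (x, t)) 0 t := by
    intro t ht
    have ht' : t < W.η (-x) := by rw [W.η_symm]; exact ht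
    have h1 := (hd (-x) t ht').add (hd x t ht)
    have h2 : deriv (fun s => W.u (s, t)) x = -deriv (fun s => W.u (s, t)) (-x) := by
      rw [← deriv_comp_neg]
      refine EventuallyEq.deriv_eq ?_
      filter_upwards [(isOpen_lt continuous_const W.continuous_η).mem_nhds ht] with s hs
      exact (W.u_symm s t (le_of_lt hs)).symm
    rw [h2] at h1
    simpa using! h1
  have hconst : ∀ t < W.η x, W.v (-x, t) + W.v (x, t) = W.v (-x, y) + W.v (x, y) :=
    fun t ht => isOpen_Iio.is_const_of_deriv_eq_zero isPreconnected_Iio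
      (fun s hs => (hk s hs).differentiableAt.differentiableWithinAt)
      (fun s hs => (hk s hs).deriv) ht hxy
  by_contra hne
  have hpos : 0 < |W.v (-x, y) + W.v (x, y)| := abs_pos.2 fun h => hne (by linarith)
  obtain ⟨Y, hY⟩ := W.rest_at_depth _ (half_pos hpos)
  have hm : min Y y < W.η x := lt_of_le_of_lt (min_le_right _ _) hxy
  have h1 := (hY (-x) (min Y y) (min_le_left _ _) (by rw [W.η_symm]; exact hm.le)).2
  have h2 := (hY x (min Y y) (min_le_left _ _) hm.le).2
  have h3 := hconst _ hm
  have h4 := abs_add_le (W.v (-x, min Y y)) (W.v (x, min Y y))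
  rw [h3] at h4
  linarith

/-- Oddness and periodicity of v. It lets φ vanish on the whole trough line and not only at one
point of it. -/
theorem v_trough {y : ℝ} (hy : y < W.η (W.L / 2)) : W.v (W.L / 2, y) = 0 := by
  have h1 := W.v_neg hy
  have h2 := W.v_periodic (-(W.L / 2)) y (by rw [W.η_symm]; exact hy.le)
  rw [show -(W.L / 2) + W.L = W.L / 2 by ring] at h2
  linarith

theorem exists_isStreamFunction_isVelocityPotential :
    ∃ φ ψ : ℝ × ℝ → ℝ, W.IsStreamFunction ψ ∧ W.IsVelocityPotential φ ψ := by
  obtain ⟨Y₀, hY⟩ := W.exists_lt_η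
  have hη := W.continuous_η
  have hucont : ContinuousOn (fun z => W.u z - W.c) {z | z.2 ≤ W.η z.1} :=
    W.u_cont.sub continuousOn_const
  have hvcont : ContinuousOn (fun z => -W.v z) {z | z.2 ≤ W.η z.1} := W.v_cont.neg
  have hudiff : ContDiffOn ℝ 1 (fun z => W.u z - W.c) {z | z.2 < W.η z.1} :=
    W.u_contDiff.sub contDiffOn_const
  have hvdiff : ContDiffOn ℝ 1 (fun z => -W.v z) {z | z.2 < W.η z.1} := W.v_contDiff.neg
  set ψ₀ := hookIntegral W.η (fun z => -W.v z) (fun z => W.u z - W.c) 0 Y₀ with hψ₀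
  set φ := hookIntegral W.η (fun z => W.u z - W.c) W.v (W.L / 2) Y₀ with hφ
  have hψc : Continuous ψ₀ := continuous_hookIntegral hη hvcont hucont
  have hψy : ∀ x y, y < W.η x → HasDerivAt (fun t => ψ₀ (x, t)) (W.u (x, y) - W.c) y :=
    fun x y h => hasDerivAt_hookIntegral_snd hη hucont h
  have hψx : ∀ x y, y < W.η x → HasDerivAt (fun t => ψ₀ (t, y)) (-W.v (x, y)) x :=
    fun x y h => hasDerivAt_hookIntegral_fst hη hvcont hucont hvdiff hudiff (fun x y h => by
      have := W.incompressible x y h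
      simp only [deriv.fun_neg, deriv_sub_const_fun]
      linarith) hY h
  have hφy : ∀ x y, y < W.η x → HasDerivAt (fun t => φ (x, t)) (W.v (x, y)) y :=
    fun x y h => hasDerivAt_hookIntegral_snd hη W.v_cont h
  have hφx : ∀ x y, y < W.η x → HasDerivAt (fun t => φ (t, y)) (W.u (x, y) - W.c) x :=
    fun x y h => hasDerivAt_hookIntegral_fst hη hucont W.v_cont hudiff W.v_contDiff (fun x y h => by
      have := W.irrotational x y h
      simp only [deriv_sub_const_fun]
      linarith) hY h
  have hsurf : ∀ x, ψ₀ (x, W.η x) = ψ₀ (0, W.η 0) := fun x =>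
    const_on_graph hη (fun x => (W.η_diff x).hasDerivAt) W.continuous_deriv_η hψc hvcont hucont
      hψx hψy (fun x => by linarith [W.kinematic x]) x 0
  refine ⟨φ, fun z => ψ₀ z - ψ₀ (0, W.η 0), ⟨?_, ?_, ?_, ?_⟩, ⟨?_, ?_, ?_⟩⟩
  · exact (hψc.sub continuous_const).continuousOn
  · exact fun x y h => (hψy x y h).sub_const _
  · exact fun x y h => (hψx x y h).sub_const _
  · exact fun x => sub_eq_zero.2 (hsurf x)
  · intro x y h
    rw [((hψy x y h).sub_const _).deriv]
    exact hφx x y h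
  · intro x y h
    rw [((hψx x y h).sub_const _).deriv, neg_neg]
    exact hφy x y h
  · intro y h
    rw [mem_domain] at h
    have h1 : ∀ s ∈ uIcc Y₀ y, extendUp W.η W.v (W.L / 2, s) = 0 := fun s hs => by
      have hs' : s < W.η (W.L / 2) := lt_of_le_of_lt hs.2 (max_lt (hY _) h)
      rw [extendUp_of_le _ hs'.le, W.v_trough hs']
    simp only [hφ, hookIntegral, intervalIntegral.integral_same, zero_add]
    rw [intervalIntegral.integral_congr h1, intervalIntegral.integral_zero]

end StokesWave

/-! ### Streamlines as graphs, and bijectivity of the hodograph transform. -/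

theorem surjective_of_add_period {g : ℝ → ℝ} (hg : Continuous g) {L κ : ℝ} (hκ : 0 < κ)
    (h : ∀ x, g (x + L) = g x + κ) : Function.Surjective g := by
  have hstep : ∀ n : ℕ, ∀ x, g (x + n * L) = g x + n * κ := by
    intro n
    induction n with
    | zero => simp
    | succ n ih =>
      intro x
      have := h (x + n * L)
      rw [ih] at this
      push_cast
      rw [show x + (n + 1) * L = x + n * L + L by ring, this]
      ring
  intro q
  obtain ⟨n, hn⟩ := exists_nat_gt (|g 0 - q| / κ)
  rw [div_lt_iff₀ hκ] at hn
  have h1 := hstep n 0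
  have h2 := hstep n (0 + -(n * L))
  rw [add_assoc, neg_add_cancel, add_zero] at h2
  have h3 := abs_lt.1 hn
  exact mem_range_of_exists_le_of_exists_ge hg
    ⟨0 + -(n * L), by linarith⟩ ⟨0 + n * L, by linarith⟩

namespace StokesWave

variable {W : StokesWave} {φ ψ : ℝ × ℝ → ℝ}

theorem u_sub_c_neg (W : StokesWave) {x y : ℝ} (h : y < W.η x) : W.u (x, y) - W.c < 0 :=
  sub_neg.2 (W.u_lt_c x y h.le)

theorem mem_domain_add_period {x y : ℝ} : (x + W.L, y) ∈ W.domain ↔ (x, y) ∈ W.domain := by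
  rw [mem_domain, mem_domain, W.η_periodic]

theorem continuousOn_u_sub_c (W : StokesWave) :
    ContinuousOn (fun z => W.u z - W.c) W.domain :=
  (W.u_cont.mono W.domain_subset).sub continuousOn_const

theorem IsVelocityPotential.hasDerivAt_fst (hφ : W.IsVelocityPotential φ ψ)
    (hψ : W.IsStreamFunction ψ) {x y : ℝ} (h : (x, y) ∈ W.domain) :
    HasDerivAt (fun s => φ (s, y)) (W.u (x, y) - W.c) x := by
  have := hφ.deriv_x x y h
  rwa [(hψ.deriv_y x y h).deriv] at this

theorem IsVelocityPotential.hasDerivAt_snd (hφ : W.IsVelocityPotential φ ψ)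
    (hψ : W.IsStreamFunction ψ) {x y : ℝ} (h : (x, y) ∈ W.domain) :
    HasDerivAt (fun s => φ (x, s)) (W.v (x, y)) y := by
  have := hφ.deriv_y x y h
  rwa [(hψ.deriv_x x y h).deriv, neg_neg] at this

theorem IsStreamFunction.hasStrictFDerivAt (hψ : W.IsStreamFunction ψ) {z : ℝ × ℝ}
    (h : z ∈ W.domain) : HasStrictFDerivAt ψ
      ((-W.v z) • ContinuousLinearMap.fst ℝ ℝ ℝ + (W.u z - W.c) • ContinuousLinearMap.snd ℝ ℝ ℝ)
      z :=
  hasStrictFDerivAt_of_continuousOn_partials (a := fun z => -W.v z) (b := fun z => W.u z - W.c)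
    W.isOpen_domain (W.v_cont.mono W.domain_subset).neg W.continuousOn_u_sub_c hψ.deriv_x
    hψ.deriv_y h

theorem IsVelocityPotential.hasStrictFDerivAt (hφ : W.IsVelocityPotential φ ψ)
    (hψ : W.IsStreamFunction ψ) {z : ℝ × ℝ} (h : z ∈ W.domain) : HasStrictFDerivAt φ
      ((W.u z - W.c) • ContinuousLinearMap.fst ℝ ℝ ℝ + W.v z • ContinuousLinearMap.snd ℝ ℝ ℝ) z :=
  hasStrictFDerivAt_of_continuousOn_partials (a := fun z => W.u z - W.c) (b := W.v)
    W.isOpen_domain W.continuousOn_u_sub_c (W.v_cont.mono W.domain_subset)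
    (fun _ _ => hφ.hasDerivAt_fst hψ) (fun _ _ => hφ.hasDerivAt_snd hψ) h

theorem IsStreamFunction.continuousOn_vertical (hψ : W.IsStreamFunction ψ) (x : ℝ) :
    ContinuousOn (fun y => ψ (x, y)) (Iic (W.η x)) :=
  hψ.cont.comp (by fun_prop) fun _ hy => hy

theorem IsStreamFunction.strictAntiOn (hψ : W.IsStreamFunction ψ) (x : ℝ) :
    StrictAntiOn (fun y => ψ (x, y)) (Iic (W.η x)) := by
  refine strictAntiOn_of_deriv_neg (convex_Iic _) (hψ.continuousOn_vertical x) fun y hy => ?_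
  rw [interior_Iic] at hy
  rw [(hψ.deriv_y x y hy).deriv]
  exact W.u_sub_c_neg hy

theorem IsStreamFunction.pos (hψ : W.IsStreamFunction ψ) {x y : ℝ} (h : (x, y) ∈ W.domain) :
    0 < ψ (x, y) := by
  have := hψ.strictAntiOn x (le_of_lt h : y ≤ W.η x) (le_refl (W.η x)) h
  simpa only [hψ.surface] using this

/-- Mean value theorem with u bounded. It shows that large p forces great depth, uniformly in x. -/
theorem IsStreamFunction.exists_le_mul (hψ : W.IsStreamFunction ψ) :
    ∃ K > 0, ∀ x y, (x, y) ∈ W.domain → ψ (x, y) ≤ K * (W.η x - y) := by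
  obtain ⟨M, hM⟩ := W.bounded
  refine ⟨W.c + |M|, by have := W.c_pos; positivity, fun x y h => ?_⟩
  have h' : y < W.η x := h
  obtain ⟨s, hs, hs'⟩ := exists_hasDerivAt_eq_slope (fun t => ψ (x, t)) (fun t => W.u (x, t) - W.c)
    h' ((hψ.continuousOn_vertical x).mono Icc_subset_Iic_self)
    fun t ht => hψ.deriv_y x t ht.2
  rw [hψ.surface, eq_div_iff (sub_pos.2 h').ne'] at hs'
  have h1 := abs_le.1 (hM (x, s) hs.2).1
  have h2 := le_abs_self M
  nlinarith [sub_pos.2 h']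

theorem IsStreamFunction.exists_gt (hψ : W.IsStreamFunction ψ) (x p : ℝ) :
    ∃ y < W.η x, p < ψ (x, y) := by
  obtain ⟨Y, hY⟩ := W.rest_at_depth (W.c / 2) (half_pos W.c_pos)
  set Y₁ := min Y (W.η x) - 1 with hY₁
  have h1 : Y₁ < Y := by linarith [min_le_left Y (W.η x)]
  have h2 : Y₁ < W.η x := by linarith [min_le_right Y (W.η x)]
  -- Below Y₁ one has ψ_y < -c/2, so this descent raises ψ by more than |p| + 1.
  set y := Y₁ - (2 / W.c) * (|p| + 1) with hy
  have hc := W.c_pos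
  have h3 : y < Y₁ := by
    have : 0 < (2 / W.c) * (|p| + 1) := by positivity
    linarith
  obtain ⟨s, hs, hs'⟩ := exists_hasDerivAt_eq_slope (fun t => ψ (x, t)) (fun t => W.u (x, t) - W.c)
    h3 ((hψ.continuousOn_vertical x).mono fun t ht => ht.2.trans h2.le)
    fun t ht => hψ.deriv_y x t (ht.2.trans h2)
  rw [eq_div_iff (sub_pos.2 h3).ne'] at hs'
  have h4 := (abs_lt.1 (hY x s (hs.2.trans h1).le (hs.2.trans h2).le).1).2
  have h5 := hψ.pos (W.mem_domain.2 h2)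
  have h6 : Y₁ - y = (2 / W.c) * (|p| + 1) := by rw [hy]; ring
  have h7 : (W.c / 2) * (Y₁ - y) = |p| + 1 := by rw [h6]; field_simp
  refine ⟨y, h3.trans h2, ?_⟩
  have h8 := le_abs_self p
  nlinarith [sub_pos.2 h3]

/-- The height of the streamline `ψ = p` above the abscissa `x`. -/
noncomputable def level (W : StokesWave) (ψ : ℝ × ℝ → ℝ) (p x : ℝ) : ℝ :=
  Function.invFunOn (fun y => ψ (x, y)) (Iio (W.η x)) p

theorem IsStreamFunction.exists_eq (hψ : W.IsStreamFunction ψ) (x : ℝ) {p : ℝ} (hp : 0 < p) :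
    ∃ y ∈ Iio (W.η x), ψ (x, y) = p := by
  obtain ⟨y₁, hy₁, hpy⟩ := hψ.exists_gt x p
  obtain ⟨y, hy, hy'⟩ := intermediate_value_Icc' hy₁.le
    ((hψ.continuousOn_vertical x).mono Icc_subset_Iic_self)
    (show p ∈ Icc _ _ from ⟨by simpa only [hψ.surface] using hp.le, hpy.le⟩)
  refine ⟨y, lt_of_le_of_ne hy.2 fun h => ?_, hy'⟩
  rw [h] at hy'
  simp only [hψ.surface] at hy'
  exact hp.ne hy'

theorem IsStreamFunction.level_lt (hψ : W.IsStreamFunction ψ) (x : ℝ) {p : ℝ} (hp : 0 < p) :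
    W.level ψ p x < W.η x :=
  Function.invFunOn_mem (hψ.exists_eq x hp)

theorem IsStreamFunction.apply_level (hψ : W.IsStreamFunction ψ) (x : ℝ) {p : ℝ} (hp : 0 < p) :
    ψ (x, W.level ψ p x) = p :=
  Function.invFunOn_eq (hψ.exists_eq x hp)

theorem IsStreamFunction.level_apply (hψ : W.IsStreamFunction ψ) {x y : ℝ}
    (h : (x, y) ∈ W.domain) : W.level ψ (ψ (x, y)) x = y :=
  (hψ.strictAntiOn x).injOn (hψ.level_lt x (hψ.pos h)).le (le_of_lt h : y ≤ W.η x)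
    (hψ.apply_level x (hψ.pos h))

/-- Implicit differentiation, through the inverse function theorem for (x, y) ↦ (x, ψ(x, y)), whose
Jacobian is u - c ≠ 0. -/
theorem IsStreamFunction.hasDerivAt_level (hψ : W.IsStreamFunction ψ) {p : ℝ} (hp : 0 < p)
    (x : ℝ) : HasDerivAt (W.level ψ p)
      (W.v (x, W.level ψ p x) / (W.u (x, W.level ψ p x) - W.c)) x := by
  set y := W.level ψ p x with hy
  have hyx : y < W.η x := hψ.level_lt x hp
  have hmem : (x, y) ∈ W.domain := hyx
  have hb : W.u (x, y) - W.c ≠ 0 := (W.u_sub_c_neg hyx).ne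
  set a := -W.v (x, y) with ha
  set b := W.u (x, y) - W.c with hbdef
  let e : (ℝ × ℝ) ≃L[ℝ] ℝ × ℝ := ContinuousLinearEquiv.equivOfInverse
    ((ContinuousLinearMap.fst ℝ ℝ ℝ).prod
      (a • ContinuousLinearMap.fst ℝ ℝ ℝ + b • ContinuousLinearMap.snd ℝ ℝ ℝ))
    ((ContinuousLinearMap.fst ℝ ℝ ℝ).prod
      ((-(a / b)) • ContinuousLinearMap.fst ℝ ℝ ℝ + b⁻¹ • ContinuousLinearMap.snd ℝ ℝ ℝ))
    (fun z => by ext <;> simp; field_simp; ring) (fun z => by ext <;> simp; field_simp; ring)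
  have hΦ : HasStrictFDerivAt (fun z : ℝ × ℝ => (z.1, ψ z)) (e : ℝ × ℝ →L[ℝ] ℝ × ℝ) (x, y) :=
    hasStrictFDerivAt_fst.prodMk (hψ.hasStrictFDerivAt hmem)
  have hval : ((x, y).1, ψ (x, y)) = (x, p) := by
    simp only [hy, hψ.apply_level x hp]
  set g := hΦ.localInverse (fun z : ℝ × ℝ => (z.1, ψ z)) e (x, y) with hg
  have hg1 : HasFDerivAt g (e.symm : ℝ × ℝ →L[ℝ] ℝ × ℝ) (x, p) := by
    have := hΦ.to_localInverse.hasFDerivAt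
    rwa [hval] at this
  have hgx : g (x, p) = (x, y) := by
    have := hΦ.localInverse_apply_image
    rwa [hval] at this
  have hright : ∀ᶠ w in 𝓝 (x, p), ((g w).1, ψ (g w)) = w := by
    have := hΦ.eventually_right_inverse
    rwa [hval] at this
  have hdom : ∀ᶠ w in 𝓝 (x, p), g w ∈ W.domain := by
    refine hg1.continuousAt.eventually_mem ?_
    rw [hgx]
    exact W.isOpen_domain.mem_nhds hmem
  have hc : Tendsto (fun t : ℝ => (t, p)) (𝓝 x) (𝓝 (x, p)) :=
    (Continuous.prodMk continuous_id continuous_const).tendsto x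
  have h1 : HasDerivAt (fun t => g (t, p)) (e.symm (1, 0)) x :=
    HasFDerivAt.comp_hasDerivAt (f := fun t => (t, p)) x hg1 ((hasDerivAt_id x).prodMk (hasDerivAt_const x p))
  have h2 : HasDerivAt (fun t => (g (t, p)).2) ((e.symm (1, 0)).2) x :=
    (ContinuousLinearMap.snd ℝ ℝ ℝ).hasFDerivAt.comp_hasDerivAt x h1
  have h3 : (e.symm (1, 0)).2 = W.v (x, y) / b := by
    change (-(a / b)) * 1 + b⁻¹ * 0 = _
    rw [ha]; ring
  rw [h3] at h2
  refine h2.congr_of_eventuallyEq ?_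
  filter_upwards [hc.eventually hright, hc.eventually hdom] with t ht1 ht2
  have ht3 : (g (t, p)).1 = t := congrArg Prod.fst ht1
  have ht4 : ψ (g (t, p)) = p := congrArg Prod.snd ht1
  have h5 := hψ.level_apply (x := (g (t, p)).1) (y := (g (t, p)).2) ht2
  rwa [Prod.mk.eta, ht4, ht3] at h5

theorem IsStreamFunction.periodic (hψ : W.IsStreamFunction ψ) {x y : ℝ}
    (h : (x, y) ∈ W.domain) : ψ (x + W.L, y) = ψ (x, y) := by
  have h' : y < W.η x := h
  have h1 := hψ.continuousOn_vertical (x + W.L)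
  rw [W.η_periodic] at h1
  have h2 := constant_of_has_deriv_right_zero (f := fun t => ψ (x + W.L, t) - ψ (x, t))
    (a := y) (b := W.η x) ((h1.sub (hψ.continuousOn_vertical x)).mono Icc_subset_Iic_self)
    (fun t ht => by
      have ht' : (x, t) ∈ W.domain := ht.2
      have h3 := (hψ.deriv_y (x + W.L) t (mem_domain_add_period.2 ht')).sub (hψ.deriv_y x t ht')
      rw [W.u_periodic x t ht.2.le, sub_self] at h3
      exact h3.hasDerivWithinAt) (W.η x) (right_mem_Icc.2 h'.le)
  have h3 := hψ.surface (x + W.L)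
  rw [W.η_periodic] at h3
  simp only [h3, hψ.surface] at h2
  linarith

/-- The gradient of φ is periodic, so the increment over a period is a constant; it is evaluated at
great depth, where φ_x tends to -c. -/
theorem IsVelocityPotential.add_period (hφ : W.IsVelocityPotential φ ψ)
    (hψ : W.IsStreamFunction ψ) {x y : ℝ} (h : (x, y) ∈ W.domain) :
    φ (x + W.L, y) = φ (x, y) - W.c * W.L := by
  obtain ⟨m, hm⟩ := W.exists_lt_η
  have hvert : ∀ x, ∀ y₁ < W.η x, ∀ y₂ < W.η x,
      φ (x + W.L, y₁) - φ (x, y₁) = φ (x + W.L, y₂) - φ (x, y₂) := by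
    intro x y₁ h₁ y₂ h₂
    have hk : ∀ t ∈ Iio (W.η x), HasDerivAt (fun t => φ (x + W.L, t) - φ (x, t)) 0 t := by
      intro t ht
      have ht' : (x, t) ∈ W.domain := ht
      have h3 := (hφ.hasDerivAt_snd hψ (mem_domain_add_period.2 ht')).sub
        (hφ.hasDerivAt_snd hψ ht')
      rwa [W.v_periodic x t (le_of_lt ht'), sub_self] at h3
    exact isOpen_Iio.is_const_of_deriv_eq_zero isPreconnected_Iio
      (fun s hs => (hk s hs).differentiableAt.differentiableWithinAt)
      (fun s hs => (hk s hs).deriv) h₁ h₂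
  have hhor : φ (x + W.L, m) - φ (x, m) = φ (0 + W.L, m) - φ (0, m) := by
    have hk : ∀ t, HasDerivAt (fun t => φ (t + W.L, m) - φ (t, m)) 0 t := by
      intro t
      have ht' : (t, m) ∈ W.domain := hm t
      have h3 := (hφ.hasDerivAt_fst hψ (mem_domain_add_period.2 ht')).comp_add_const t W.L
      have h4 := h3.sub (hφ.hasDerivAt_fst hψ ht')
      rwa [W.u_periodic t m (hm t).le, sub_self] at h4
    exact is_const_of_deriv_eq_zero (fun t => (hk t).differentiableAt) (fun t => (hk t).deriv) x 0
  have hL := W.L_pos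
  rw [zero_add] at hhor
  have hval : φ (W.L, m) - φ (0, m) = -(W.c * W.L) := by
    by_contra hne
    set k := φ (W.L, m) - φ (0, m) with hk
    have hpos : 0 < |k + W.c * W.L| := abs_pos.2 fun h => hne (by linarith)
    obtain ⟨Y, hY⟩ := W.rest_at_depth (|k + W.c * W.L| / W.L) (by positivity)
    set Y₁ := min Y m with hY₁
    have h1 : ∀ x, Y₁ < W.η x := fun x => lt_of_le_of_lt (min_le_right _ _) (hm x)
    -- The mean value theorem gives k + cL = u(s, Y₁) L, which contradicts the smallness of u at
    -- depth Y₁.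
    obtain ⟨s, -, hs⟩ := exists_hasDerivAt_eq_slope (fun t => φ (t, Y₁))
      (fun t => W.u (t, Y₁) - W.c) hL
      (fun t _ => (hφ.hasDerivAt_fst hψ (h1 t)).continuousAt.continuousWithinAt)
      fun t _ => hφ.hasDerivAt_fst hψ (h1 t)
    have h2 := hvert 0 Y₁ (h1 0) m (hm 0)
    rw [zero_add] at h2
    rw [h2, ← hk, sub_zero, eq_div_iff hL.ne'] at hs
    have h3 := (hY s Y₁ (min_le_left _ _) (h1 s).le).1
    rw [lt_div_iff₀ hL] at h3
    have h4 : k + W.c * W.L = W.u (s, Y₁) * W.L := by linarith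
    rw [h4, abs_mul, abs_of_pos hL] at h3
    exact lt_irrefl _ h3
  have := hvert x y h m (hm x)
  linarith

theorem IsStreamFunction.level_add_period (hψ : W.IsStreamFunction ψ) {p : ℝ} (hp : 0 < p)
    (x : ℝ) : W.level ψ p (x + W.L) = W.level ψ p x := by
  have hmem : (x, W.level ψ p x) ∈ W.domain := hψ.level_lt x hp
  have h := hψ.level_apply (mem_domain_add_period.2 hmem)
  rwa [hψ.periodic hmem, hψ.apply_level x hp] at h

theorem energy_pos (W : StokesWave) {z : ℝ × ℝ} (h : z ∈ W.domain) : 0 < W.energy z := by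
  have h1 : W.u z - W.c < 0 := W.u_sub_c_neg (x := z.1) (y := z.2) h
  have h2 := pow_pos (neg_pos.2 h1) 2
  unfold energy
  nlinarith [sq_nonneg (W.v z)]

theorem IsVelocityPotential.hasDerivAt_level (hφ : W.IsVelocityPotential φ ψ)
    (hψ : W.IsStreamFunction ψ) {p : ℝ} (hp : 0 < p) (x : ℝ) :
    HasDerivAt (fun t => φ (t, W.level ψ p t))
      (2 * W.energy (x, W.level ψ p x) / (W.u (x, W.level ψ p x) - W.c)) x := by
  have hmem : (x, W.level ψ p x) ∈ W.domain := hψ.level_lt x hp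
  have h := (hφ.hasStrictFDerivAt hψ hmem).hasFDerivAt.comp_hasDerivAt x
    ((hasDerivAt_id x).prodMk (hψ.hasDerivAt_level hp x))
  have hb := (W.u_sub_c_neg hmem).ne
  refine h.congr_deriv ?_
  simp [energy]
  field_simp

theorem IsVelocityPotential.strictAnti_level (hφ : W.IsVelocityPotential φ ψ)
    (hψ : W.IsStreamFunction ψ) {p : ℝ} (hp : 0 < p) :
    StrictAnti fun x => φ (x, W.level ψ p x) := by
  refine strictAnti_of_deriv_neg fun x => ?_
  rw [(hφ.hasDerivAt_level hψ hp x).deriv]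
  have hmem : (x, W.level ψ p x) ∈ W.domain := hψ.level_lt x hp
  exact div_neg_of_pos_of_neg (by have := W.energy_pos hmem; positivity) (W.u_sub_c_neg hmem)

theorem IsVelocityPotential.surjective_level (hφ : W.IsVelocityPotential φ ψ)
    (hψ : W.IsStreamFunction ψ) {p : ℝ} (hp : 0 < p) :
    Function.Surjective fun x => φ (x, W.level ψ p x) := by
  refine surjective_of_add_period (continuous_iff_continuousAt.2 fun x =>
    (hφ.hasDerivAt_level hψ hp x).continuousAt) (mul_pos W.c_pos W.L_pos) (L := -W.L) fun x => ?_
  have hmem : (x + -W.L, W.level ψ p (x + -W.L)) ∈ W.domain := hψ.level_lt _ hp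
  have h1 := hψ.level_add_period hp (x + -W.L)
  have h2 := hφ.add_period hψ hmem
  rw [← h1, neg_add_cancel_right] at h2
  rw [← h1, neg_add_cancel_right]
  linarith

/-- ψ picks out the streamline, which is a graph over x, and φ maps that streamline bijectively onto
ℝ. -/
theorem hodograph_bijOn (hψ : W.IsStreamFunction ψ) (hφ : W.IsVelocityPotential φ ψ) :
    BijOn (hodograph φ ψ) W.domain {w : ℂ | 0 < w.im} := by
  refine ⟨fun z hz => hψ.pos (x := z.1) (y := z.2) hz, ?_, ?_⟩
  · rintro ⟨x₁, y₁⟩ h₁ ⟨x₂, y₂⟩ h₂ heq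
    have hre : φ (x₁, y₁) = φ (x₂, y₂) := congrArg Complex.re heq
    have him : ψ (x₁, y₁) = ψ (x₂, y₂) := congrArg Complex.im heq
    have e1 := hψ.level_apply h₁
    have e2 := hψ.level_apply h₂
    rw [← him] at e2
    have hx : x₁ = x₂ := (hφ.strictAnti_level hψ (hψ.pos h₁)).injective
      (by simp only [e1, e2, hre])
    subst hx
    rw [← e1, ← e2]
  · intro w hw
    have hw : 0 < w.im := hw
    obtain ⟨x, hx⟩ := hφ.surjective_level hψ hw w.re
    exact ⟨(x, W.level ψ w.im x), hψ.level_lt x hw, Complex.ext hx (hψ.apply_level x hw)⟩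

/-! ### Conformality, and the reciprocal velocity in the hodograph plane. -/

theorem hasDerivAt_hodograph (hψ : W.IsStreamFunction ψ) (hφ : W.IsVelocityPotential φ ψ) {ζ : ℂ}
    (h : (ζ.re, ζ.im) ∈ W.domain) :
    HasDerivAt (fun ζ : ℂ => hodograph φ ψ (ζ.re, ζ.im)) (W.complexVelocity (ζ.re, ζ.im)) ζ := by
  have he : HasFDerivAt (fun ζ : ℂ => (ζ.re, ζ.im)) (Complex.reCLM.prod Complex.imCLM) ζ :=
    Complex.reCLM.hasFDerivAt.prodMk Complex.imCLM.hasFDerivAt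
  have h1 := (hφ.hasStrictFDerivAt hψ h).hasFDerivAt.comp ζ he
  have h2 := (hψ.hasStrictFDerivAt h).hasFDerivAt.comp ζ he
  have h3 := Complex.equivRealProdCLM.symm.hasFDerivAt.comp ζ (h1.prodMk h2)
  have h4 : HasFDerivAt (fun ζ : ℂ => hodograph φ ψ (ζ.re, ζ.im))
      (ContinuousLinearMap.toSpanSingleton ℂ (W.complexVelocity (ζ.re, ζ.im))) ζ := by
    refine hasFDerivAt_of_restrictScalars ℝ h3 ?_
    ext z
    apply Complex.ext <;> simp [complexVelocity] <;> ring
  exact h4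

theorem hodographInv_mem (hψ : W.IsStreamFunction ψ) (hφ : W.IsVelocityPotential φ ψ) {w : ℂ}
    (hw : 0 < w.im) : W.hodographInv φ ψ w ∈ W.domain :=
  Function.invFunOn_mem ((hodograph_bijOn hψ hφ).surjOn hw)

theorem hodograph_hodographInv (hψ : W.IsStreamFunction ψ) (hφ : W.IsVelocityPotential φ ψ)
    {w : ℂ} (hw : 0 < w.im) : hodograph φ ψ (W.hodographInv φ ψ w) = w :=
  Function.invFunOn_eq ((hodograph_bijOn hψ hφ).surjOn hw)

theorem hodographInv_eq_iff (hψ : W.IsStreamFunction ψ) (hφ : W.IsVelocityPotential φ ψ)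
    {w : ℂ} (hw : 0 < w.im) {z : ℝ × ℝ} (hz : z ∈ W.domain) :
    W.hodographInv φ ψ w = z ↔ hodograph φ ψ z = w := by
  constructor
  · rintro rfl
    exact hodograph_hodographInv hψ hφ hw
  · intro h
    exact (hodograph_bijOn hψ hφ).injOn (hodographInv_mem hψ hφ hw) hz
      ((hodograph_hodographInv hψ hφ hw).trans h.symm)

theorem hodographInv_hodograph (hψ : W.IsStreamFunction ψ) (hφ : W.IsVelocityPotential φ ψ)
    {z : ℝ × ℝ} (hz : z ∈ W.domain) : W.hodographInv φ ψ (hodograph φ ψ z) = z :=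
  (hodographInv_eq_iff hψ hφ ((hodograph_bijOn hψ hφ).mapsTo hz) hz).2 rfl

theorem complexVelocity_ne_zero (W : StokesWave) {z : ℝ × ℝ} (hz : z ∈ W.domain) :
    W.complexVelocity z ≠ 0 := fun h =>
  (W.u_sub_c_neg (x := z.1) (y := z.2) hz).ne (congrArg Complex.re h)

theorem norm_complexVelocity_sq (W : StokesWave) (z : ℝ × ℝ) :
    ‖W.complexVelocity z‖ ^ 2 = 2 * W.energy z := by
  rw [← Complex.normSq_eq_norm_sq, Complex.normSq_apply, complexVelocity, energy]
  ring

theorem isOpen_complexDomain (W : StokesWave) : IsOpen {ζ : ℂ | (ζ.re, ζ.im) ∈ W.domain} :=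
  W.isOpen_domain.preimage (Complex.continuous_re.prodMk Complex.continuous_im)

theorem analyticAt_hodograph (hψ : W.IsStreamFunction ψ) (hφ : W.IsVelocityPotential φ ψ) {ζ : ℂ}
    (h : (ζ.re, ζ.im) ∈ W.domain) :
    AnalyticAt ℂ (fun ζ : ℂ => hodograph φ ψ (ζ.re, ζ.im)) ζ :=
  DifferentiableOn.analyticAt (s := {ζ : ℂ | (ζ.re, ζ.im) ∈ W.domain})
    (fun _ hz => (hasDerivAt_hodograph hψ hφ hz).differentiableAt.differentiableWithinAt)
    (W.isOpen_complexDomain.mem_nhds h)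

/-- The complex velocity is the derivative of the holomorphic function h. -/
theorem differentiableAt_complexVelocity (hψ : W.IsStreamFunction ψ)
    (hφ : W.IsVelocityPotential φ ψ) {ζ : ℂ} (h : (ζ.re, ζ.im) ∈ W.domain) :
    DifferentiableAt ℂ (fun ζ : ℂ => W.complexVelocity (ζ.re, ζ.im)) ζ := by
  refine (analyticAt_hodograph hψ hφ h).deriv.differentiableAt.congr_of_eventuallyEq ?_
  filter_upwards [W.isOpen_complexDomain.mem_nhds h] with z hz
  exact (hasDerivAt_hodograph hψ hφ hz).deriv.symm

theorem hasDerivAt_hodographInv (hψ : W.IsStreamFunction ψ) (hφ : W.IsVelocityPotential φ ψ)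
    {w : ℂ} (hw : 0 < w.im) :
    HasDerivAt (fun w => Complex.equivRealProdCLM.symm (W.hodographInv φ ψ w))
      (W.complexVelocity (W.hodographInv φ ψ w))⁻¹ w := by
  set ζ : ℂ := Complex.equivRealProdCLM.symm (W.hodographInv φ ψ w) with hζ
  have hζ' : (ζ.re, ζ.im) = W.hodographInv φ ψ w := by simp [hζ]
  have hmem : (ζ.re, ζ.im) ∈ W.domain := hζ' ▸ hodographInv_mem hψ hφ hw
  have hval : hodograph φ ψ (ζ.re, ζ.im) = w := by rw [hζ', hodograph_hodographInv hψ hφ hw]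
  have hs := (analyticAt_hodograph hψ hφ hmem).hasStrictDerivAt
  rw [(hasDerivAt_hodograph hψ hφ hmem).deriv] at hs
  have hne := W.complexVelocity_ne_zero hmem
  set g := hs.localInverse _ _ _ hne with hg
  have h1 : HasDerivAt g (W.complexVelocity (ζ.re, ζ.im))⁻¹ w := by
    have := (hs.to_localInverse hne).hasDerivAt
    rwa [hval] at this
  have h2 : ∀ᶠ w' in 𝓝 w, hodograph φ ψ ((g w').re, (g w').im) = w' := by
    have := hs.eventually_right_inverse hne
    rwa [hval] at this
  have h3 : g w = ζ := by
    have := (hs.hasStrictFDerivAt_equiv hne).localInverse_apply_image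
    rwa [hval] at this
  have h4 : ∀ᶠ w' in 𝓝 w, ((g w').re, (g w').im) ∈ W.domain :=
    h1.continuousAt.eventually_mem (W.isOpen_complexDomain.mem_nhds (by rw [h3]; exact hmem))
  rw [← hζ']
  refine h1.congr_of_eventuallyEq ?_
  filter_upwards [h2, h4] with w' h5 h6
  have h7 := hodographInv_hodograph hψ hφ h6
  rw [h5] at h7
  rw [h7]
  apply Complex.ext <;> simp

theorem hodographInv_add_period (hψ : W.IsStreamFunction ψ) (hφ : W.IsVelocityPotential φ ψ)
    {w : ℂ} (hw : 0 < w.im) : W.hodographInv φ ψ (w + (W.c * W.L : ℝ))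
      = ((W.hodographInv φ ψ w).1 - W.L, (W.hodographInv φ ψ w).2) := by
  set z := W.hodographInv φ ψ w with hz
  have hzw : hodograph φ ψ z = w := hodograph_hodographInv hψ hφ hw
  have hzD : (z.1, z.2) ∈ W.domain := hodographInv_mem hψ hφ hw
  have hmem : (z.1 - W.L, z.2) ∈ W.domain := by
    rw [← mem_domain_add_period, sub_add_cancel]
    exact hzD
  have h1 := hφ.add_period hψ hmem
  have h2 := hψ.periodic hmem
  rw [sub_add_cancel] at h1 h2
  refine (hodographInv_eq_iff hψ hφ (by simpa using hw) hmem).2 (Complex.ext ?_ ?_)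
  · have h3 : φ z = w.re := congrArg Complex.re hzw
    simp only [hodograph, Complex.add_re, Complex.ofReal_re]
    rw [Prod.mk.eta] at h1
    linarith
  · have h3 : ψ z = w.im := congrArg Complex.im hzw
    simp only [hodograph, Complex.add_im, Complex.ofReal_im]
    rw [Prod.mk.eta] at h2
    linarith

theorem complexVelocity_periodic (W : StokesWave) {x y : ℝ} (h : (x, y) ∈ W.domain) :
    W.complexVelocity (x - W.L, y) = W.complexVelocity (x, y) := by
  have h' : y ≤ W.η (x - W.L) := by
    have h1 := W.η_periodic (x - W.L)
    rw [sub_add_cancel] at h1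
    rw [← h1]
    exact le_of_lt h
  have h1 := W.u_periodic (x - W.L) y h'
  have h2 := W.v_periodic (x - W.L) y h'
  rw [sub_add_cancel] at h1 h2
  simp only [complexVelocity, h1, h2]

open Classical in
/-- The reciprocal of the complex velocity in the upper half of the `(q, p)`-plane. -/
noncomputable def invVelocity (W : StokesWave) (φ ψ : ℝ × ℝ → ℝ) (w : ℂ) : ℂ :=
  if 0 < w.im then (W.complexVelocity (W.hodographInv φ ψ w))⁻¹ else 0

theorem invVelocity_of_pos {w : ℂ} (hw : 0 < w.im) :
    W.invVelocity φ ψ w = (W.complexVelocity (W.hodographInv φ ψ w))⁻¹ := if_pos hw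

theorem differentiableOn_invVelocity (hψ : W.IsStreamFunction ψ)
    (hφ : W.IsVelocityPotential φ ψ) :
    DifferentiableOn ℂ (W.invVelocity φ ψ) {w | 0 < w.im} := by
  intro w hw
  have hw : 0 < w.im := hw
  have hmem := hodographInv_mem hψ hφ hw
  have h1 := (hasDerivAt_hodographInv hψ hφ hw).differentiableAt
  have h2 := DifferentiableAt.comp w (differentiableAt_complexVelocity hψ hφ
    (ζ := Complex.equivRealProdCLM.symm (W.hodographInv φ ψ w)) (by simpa using hmem)) h1
  have h3 := h2.inv (by simpa using W.complexVelocity_ne_zero hmem)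
  refine DifferentiableAt.differentiableWithinAt (h3.congr_of_eventuallyEq ?_)
  filter_upwards [(isOpen_lt continuous_const Complex.continuous_im).mem_nhds hw] with w' hw'
  simp [invVelocity_of_pos hw']

/-- The value 0 off the upper half-plane makes periodicity hold on all of ℂ, as the passage to the
cusp function requires. -/
theorem periodic_invVelocity (hψ : W.IsStreamFunction ψ) (hφ : W.IsVelocityPotential φ ψ) :
    Function.Periodic (W.invVelocity φ ψ) (W.c * W.L : ℝ) := by
  intro w
  by_cases hw : 0 < w.im
  · rw [invVelocity_of_pos (by simpa using hw), invVelocity_of_pos hw,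
      hodographInv_add_period hψ hφ hw, complexVelocity_periodic W
        (show ((W.hodographInv φ ψ w).1, (W.hodographInv φ ψ w).2) ∈ W.domain from
          hodographInv_mem hψ hφ hw)]
  · have hw' : ¬ 0 < (w + (W.c * W.L : ℝ)).im := by simpa using hw
    rw [invVelocity, if_neg hw', invVelocity, if_neg hw]

/-- For large p the point h⁻¹(w) lies so deep that u < c/2, whence |h'| ≥ c/2. -/
theorem boundedAtFilter_invVelocity (hψ : W.IsStreamFunction ψ)
    (hφ : W.IsVelocityPotential φ ψ) :
    (comap Complex.im atTop).BoundedAtFilter (W.invVelocity φ ψ) := by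
  obtain ⟨K, hK, hψK⟩ := hψ.exists_le_mul
  obtain ⟨m, hm⟩ := W.exists_η_le
  obtain ⟨Y, hY⟩ := W.rest_at_depth (W.c / 2) (half_pos W.c_pos)
  have hc := W.c_pos
  refine Asymptotics.IsBigO.of_bound (2 / W.c) ?_
  filter_upwards [preimage_mem_comap (Ioi_mem_atTop (max 0 (K * (m - Y))))] with w hw
  have hw0 : 0 < w.im := (le_max_left _ _).trans_lt hw
  have hwK : K * (m - Y) < w.im := (le_max_right _ _).trans_lt hw
  rw [invVelocity_of_pos hw0]
  set z := W.hodographInv φ ψ w with hz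
  have hmem : (z.1, z.2) ∈ W.domain := hodographInv_mem hψ hφ hw0
  have h1 : ψ z = w.im := congrArg Complex.im (hodograph_hodographInv hψ hφ hw0)
  have h2 := hψK z.1 z.2 hmem
  rw [Prod.mk.eta, h1] at h2
  have h3 : z.2 < Y := by
    have h4 := hwK.trans_le h2
    have h5 := lt_of_mul_lt_mul_left h4 hK.le
    linarith [hm z.1]
  have h4 := (abs_lt.1 (hY z.1 z.2 h3.le (le_of_lt hmem)).1).2
  have h5 : W.c / 2 ≤ ‖W.complexVelocity z‖ := by
    refine le_trans ?_ (Complex.abs_re_le_norm _)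
    refine le_trans ?_ (neg_le_abs _)
    simp only [complexVelocity]
    linarith
  rw [norm_inv]
  simp only [Pi.one_apply, norm_one, mul_one]
  calc ‖W.complexVelocity z‖⁻¹ ≤ (W.c / 2)⁻¹ := inv_anti₀ (half_pos hc) h5
    _ = 2 / W.c := inv_div _ _

theorem norm_invVelocity_sq {w : ℂ} (hw : 0 < w.im) :
    ‖W.invVelocity φ ψ w‖ ^ 2 = 1 / (2 * W.energy (W.hodographInv φ ψ w)) := by
  rw [invVelocity_of_pos hw, norm_inv, inv_pow, norm_complexVelocity_sq, one_div]

/-! ### The passage time along a streamline. -/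

/-- The time in which a particle on the streamline `p` passes from `0` to `q` in the
`(q, p)`-plane. -/
noncomputable def passageTime (W : StokesWave) (φ ψ : ℝ × ℝ → ℝ) (p q : ℝ) : ℝ :=
  ∫ s in (0 : ℝ)..q, 1 / (2 * W.energy (W.hodographInv φ ψ ⟨s, p⟩))

theorem continuous_inv_energy (hψ : W.IsStreamFunction ψ) (hφ : W.IsVelocityPotential φ ψ)
    {p : ℝ} (hp : 0 < p) :
    Continuous fun q : ℝ => 1 / (2 * W.energy (W.hodographInv φ ψ ⟨q, p⟩)) := by
  have h1 : Continuous fun q : ℝ => W.invVelocity φ ψ ⟨q, p⟩ := by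
    refine (differentiableOn_invVelocity hψ hφ).continuousOn.comp_continuous ?_ fun q => hp
    have : Continuous fun q : ℝ => (q : ℂ) + p * Complex.I := by fun_prop
    simpa only [← Complex.mk_eq_add_mul_I] using this
  have h2 : Continuous fun q : ℝ => ‖W.invVelocity φ ψ ⟨q, p⟩‖ ^ 2 := h1.norm.pow 2
  simpa only [norm_invVelocity_sq (W := W) (φ := φ) (ψ := ψ) (w := ⟨_, p⟩) hp] using h2

theorem energy_hodographInv_pos (hψ : W.IsStreamFunction ψ) (hφ : W.IsVelocityPotential φ ψ)
    {p : ℝ} (hp : 0 < p) (q : ℝ) : 0 < W.energy (W.hodographInv φ ψ ⟨q, p⟩) :=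
  W.energy_pos (hodographInv_mem hψ hφ hp)

theorem hasDerivAt_passageTime (hψ : W.IsStreamFunction ψ) (hφ : W.IsVelocityPotential φ ψ)
    {p : ℝ} (hp : 0 < p) (q : ℝ) : HasDerivAt (W.passageTime φ ψ p)
      (1 / (2 * W.energy (W.hodographInv φ ψ ⟨q, p⟩))) q :=
  ((continuous_inv_energy hψ hφ hp).integral_hasStrictDerivAt 0 q).hasDerivAt

theorem strictMono_passageTime (hψ : W.IsStreamFunction ψ) (hφ : W.IsVelocityPotential φ ψ)
    {p : ℝ} (hp : 0 < p) : StrictMono (W.passageTime φ ψ p) := by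
  refine strictMono_of_deriv_pos fun q => ?_
  rw [(hasDerivAt_passageTime hψ hφ hp q).deriv]
  have := energy_hodographInv_pos hψ hφ hp q
  positivity

theorem passageTime_zero (p : ℝ) : W.passageTime φ ψ p 0 = 0 :=
  intervalIntegral.integral_same

theorem passageTime_period_pos (hψ : W.IsStreamFunction ψ) (hφ : W.IsVelocityPotential φ ψ)
    {p : ℝ} (hp : 0 < p) : 0 < W.passageTime φ ψ p (W.c * W.L) := by
  have := strictMono_passageTime hψ hφ hp (mul_pos W.c_pos W.L_pos)
  rwa [passageTime_zero] at this

theorem passageTime_add_period (hψ : W.IsStreamFunction ψ) (hφ : W.IsVelocityPotential φ ψ)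
    {p : ℝ} (hp : 0 < p) (q : ℝ) : W.passageTime φ ψ p (q + W.c * W.L)
      = W.passageTime φ ψ p q + W.passageTime φ ψ p (W.c * W.L) := by
  have hper : Function.Periodic
      (fun q : ℝ => 1 / (2 * W.energy (W.hodographInv φ ψ ⟨q, p⟩))) (W.c * W.L) := by
    intro q
    have h := periodic_invVelocity hψ hφ ⟨q, p⟩
    have h' : (⟨q, p⟩ : ℂ) + (W.c * W.L : ℝ) = ⟨q + W.c * W.L, p⟩ := by
      apply Complex.ext <;> simp
    rw [h'] at h
    have h2 := congrArg (fun r => ‖r‖ ^ 2) h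
    simpa only [norm_invVelocity_sq (W := W) (φ := φ) (ψ := ψ) (w := ⟨_, p⟩) hp] using h2
  have hc := continuous_inv_energy hψ hφ hp
  have h1 := intervalIntegral.integral_add_adjacent_intervals
    (hc.intervalIntegrable (μ := MeasureTheory.volume) 0 q)
    (hc.intervalIntegrable q (q + W.c * W.L))
  have h2 := hper.intervalIntegral_add_eq q 0
  rw [zero_add] at h2
  rw [h2] at h1
  exact h1.symm

theorem surjective_passageTime (hψ : W.IsStreamFunction ψ) (hφ : W.IsVelocityPotential φ ψ)
    {p : ℝ} (hp : 0 < p) : Function.Surjective (W.passageTime φ ψ p) :=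
  surjective_of_add_period (continuous_iff_continuousAt.2 fun q =>
    (hasDerivAt_passageTime hψ hφ hp q).continuousAt) (passageTime_period_pos hψ hφ hp)
    (passageTime_add_period hψ hφ hp)

theorem exists_hasSum_exp_passageTime (hψ : W.IsStreamFunction ψ)
    (hφ : W.IsVelocityPotential φ ψ) :
    ∃ a : ℕ → ℝ, (∀ n, 0 ≤ a n) ∧ ∀ p : ℝ, 0 < p →
      HasSum (fun n : ℕ => a n * Real.exp (-(4 * Real.pi * n / (W.c * W.L)) * p))
        (W.passageTime φ ψ p (W.c * W.L)) := by
  obtain ⟨a, ha, h⟩ := exists_hasSum_exp_of_periodic_holomorphic (mul_pos W.c_pos W.L_pos)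
    (differentiableOn_invVelocity hψ hφ) (periodic_invVelocity hψ hφ)
    (boundedAtFilter_invVelocity hψ hφ)
  refine ⟨a, ha, fun p hp => ?_⟩
  have h1 := h p hp
  simp only [norm_invVelocity_sq (W := W) (φ := φ) (ψ := ψ) (w := ⟨_, p⟩) hp] at h1
  exact h1

/-! ### Particle paths. -/

/-- The position, in the moving frame, of a particle with fixed-frame path `X`. -/
def movingFrame (W : StokesWave) (X : ℝ → ℝ × ℝ) (t : ℝ) : ℝ × ℝ :=
  ((X t).1 - W.c * t, (X t).2)

theorem IsParticlePath.hasDerivAt_movingFrame {X : ℝ → ℝ × ℝ} (hX : W.IsParticlePath X) (t : ℝ) :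
    HasDerivAt (W.movingFrame X) (W.u (W.movingFrame X t) - W.c, W.v (W.movingFrame X t)) t := by
  have h := (hX t).2
  have h1 : HasDerivAt (fun t => (X t).1) (W.u (W.movingFrame X t)) t :=
    (ContinuousLinearMap.fst ℝ ℝ ℝ).hasFDerivAt.comp_hasDerivAt t h
  have h2 : HasDerivAt (fun t => (X t).2) (W.v (W.movingFrame X t)) t :=
    (ContinuousLinearMap.snd ℝ ℝ ℝ).hasFDerivAt.comp_hasDerivAt t h
  have h3 := h1.sub ((hasDerivAt_id t).const_mul W.c)
  rw [mul_one] at h3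
  exact h3.prodMk h2

theorem IsParticlePath.streamFunction_eq {X : ℝ → ℝ × ℝ} (hX : W.IsParticlePath X)
    (hψ : W.IsStreamFunction ψ) (t t₀ : ℝ) :
    ψ (W.movingFrame X t) = ψ (W.movingFrame X t₀) := by
  have h : ∀ t, HasDerivAt (fun t => ψ (W.movingFrame X t)) 0 t := fun t => by
    have h1 := (hψ.hasStrictFDerivAt (hX t).1).hasFDerivAt.comp_hasDerivAt t
      (hX.hasDerivAt_movingFrame t)
    refine h1.congr_deriv ?_
    simp [movingFrame]
    ring
  exact is_const_of_deriv_eq_zero (fun t => (h t).differentiableAt) (fun t => (h t).deriv) t t₀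

theorem IsParticlePath.hasDerivAt_potential {X : ℝ → ℝ × ℝ} (hX : W.IsParticlePath X)
    (hψ : W.IsStreamFunction ψ) (hφ : W.IsVelocityPotential φ ψ) (t : ℝ) :
    HasDerivAt (fun t => φ (W.movingFrame X t)) (2 * W.energy (W.movingFrame X t)) t := by
  have h1 := (hφ.hasStrictFDerivAt hψ (hX t).1).hasFDerivAt.comp_hasDerivAt t
    (hX.hasDerivAt_movingFrame t)
  refine h1.congr_deriv ?_
  simp [movingFrame, energy]
  ring

/-- The clock: φ grows at rate 2E along the path while the passage time has q-derivative 1/(2E). -/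
theorem IsParticlePath.passageTime_eq {X : ℝ → ℝ × ℝ} (hX : W.IsParticlePath X)
    (hψ : W.IsStreamFunction ψ) (hφ : W.IsVelocityPotential φ ψ) {p t₀ : ℝ}
    (hp : ψ (W.movingFrame X t₀) = p) (t : ℝ) :
    W.passageTime φ ψ p (φ (W.movingFrame X t))
      = W.passageTime φ ψ p (φ (W.movingFrame X t₀)) + (t - t₀) := by
  have hp0 : 0 < p := hp ▸ hψ.pos (hX t₀).1
  have h : ∀ t, HasDerivAt (fun t => W.passageTime φ ψ p (φ (W.movingFrame X t)) - t) 0 t := by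
    intro t
    have h1 := (hasDerivAt_passageTime hψ hφ hp0 (φ (W.movingFrame X t))).comp t
      (hX.hasDerivAt_potential hψ hφ t)
    have h2 : W.hodographInv φ ψ ⟨φ (W.movingFrame X t), p⟩ = W.movingFrame X t := by
      rw [← hp, ← hX.streamFunction_eq hψ t t₀]
      exact hodographInv_hodograph hψ hφ (hX t).1
    have h3 := W.energy_pos (hX t).1
    have h4 : 1 / (2 * W.energy (W.movingFrame X t)) * (2 * W.energy (W.movingFrame X t)) = 1 :=
      one_div_mul_cancel (mul_pos two_pos h3).ne'
    rw [h2, h4] at h1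
    have h5 := h1.sub (hasDerivAt_id t)
    rw [sub_self] at h5
    exact h5
  have := is_const_of_deriv_eq_zero (fun t => (h t).differentiableAt) (fun t => (h t).deriv) t t₀
  linarith

/-- The clock determines φ and conservation determines ψ, so injectivity of h fixes the position at
every time. -/
theorem IsParticlePath.ext {X X' : ℝ → ℝ × ℝ} (hX : W.IsParticlePath X)
    (hX' : W.IsParticlePath X') (hψ : W.IsStreamFunction ψ) (hφ : W.IsVelocityPotential φ ψ)
    {t₀ : ℝ} (h : X t₀ = X' t₀) : X = X' := by
  have h0 : W.movingFrame X t₀ = W.movingFrame X' t₀ := by simp only [movingFrame, h]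
  funext t
  have h1 := hX.passageTime_eq hψ hφ (rfl (a := ψ (W.movingFrame X t₀))) t
  have h2 := hX'.passageTime_eq hψ hφ (congrArg ψ h0.symm) t
  rw [← h0, ← h1] at h2
  have h3 := (strictMono_passageTime hψ hφ (hψ.pos (hX t₀).1)).injective h2
  have h4 : ψ (W.movingFrame X' t) = ψ (W.movingFrame X t) := by
    rw [hX.streamFunction_eq hψ t t₀, hX'.streamFunction_eq hψ t t₀, h0]
  have h5 : W.movingFrame X' t = W.movingFrame X t :=
    (hodograph_bijOn hψ hφ).injOn (hX' t).1 (hX t).1 (Complex.ext h3 h4)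
  have h6 := congrArg Prod.fst h5
  have h7 := congrArg Prod.snd h5
  simp only [movingFrame, sub_left_inj] at h6 h7
  exact (Prod.ext h6 h7).symm

/-- The clock is an increasing bijection of ℝ; its inverse gives q(t) for all times, and h⁻¹ carries
this motion back to the fluid. -/
theorem exists_isParticlePath (hψ : W.IsStreamFunction ψ) (hφ : W.IsVelocityPotential φ ψ)
    {t₀ x₀ y₀ : ℝ} (h₀ : (x₀ - W.c * t₀, y₀) ∈ W.domain) :
    ∃ X : ℝ → ℝ × ℝ, W.IsParticlePath X ∧ X t₀ = (x₀, y₀) := by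
  set z₀ : ℝ × ℝ := (x₀ - W.c * t₀, y₀) with hz₀
  set p := ψ z₀ with hpdef
  have hp : 0 < p := hψ.pos h₀
  set τ := W.passageTime φ ψ p with hτ
  set σ := (strictMono_passageTime hψ hφ hp).orderIsoOfSurjective τ
    (surjective_passageTime hψ hφ hp) with hσ
  have hτσ : ∀ r, τ (σ.symm r) = r := fun r => σ.apply_symm_apply r
  have hστ : ∀ q, σ.symm (τ q) = q := fun q => σ.symm_apply_apply q
  have hσd : ∀ r, HasDerivAt σ.symm (2 * W.energy (W.hodographInv φ ψ ⟨σ.symm r, p⟩)) r := by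
    intro r
    have hpos := energy_hodographInv_pos hψ hφ hp (σ.symm r)
    have := HasDerivAt.of_local_left_inverse (f := τ) (g := σ.symm) (a := r)
      σ.symm.continuous.continuousAt (hasDerivAt_passageTime hψ hφ hp (σ.symm r))
      (by positivity) (Eventually.of_forall hτσ)
    simpa using this
  set q : ℝ → ℝ := fun t => σ.symm (τ (φ z₀) + (t - t₀)) with hq
  set z : ℝ → ℝ × ℝ := fun t => W.hodographInv φ ψ ⟨q t, p⟩ with hz
  have hzD : ∀ t, z t ∈ W.domain := fun t => hodographInv_mem hψ hφ hp
  have hqd : ∀ t, HasDerivAt q (2 * W.energy (z t)) t := fun t => by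
    have h1 := (hσd (τ (φ z₀) + (t - t₀))).comp t
      (((hasDerivAt_id t).sub_const t₀).const_add (τ (φ z₀)))
    rw [mul_one] at h1
    exact h1
  -- Chain rule: q' / h' = |h'|² / h' = conj h' = (u - c) + iv.
  have hzd : ∀ t, HasDerivAt (fun t => (Complex.equivRealProdCLM.symm (z t) : ℂ))
      ((W.u (z t) - W.c : ℝ) + (W.v (z t) : ℝ) * Complex.I) t := fun t => by
    have h1 : HasDerivAt (fun t => (⟨q t, p⟩ : ℂ)) ((2 * W.energy (z t) : ℝ) : ℂ) t := by
      simp only [Complex.mk_eq_add_mul_I]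
      exact (hqd t).ofReal_comp.add_const _
    have h2 := (hasDerivAt_hodographInv hψ hφ (w := ⟨q t, p⟩) hp).scomp t h1
    refine h2.congr_deriv ?_
    change ((2 * W.energy (z t) : ℝ) : ℂ) * (W.complexVelocity (z t))⁻¹ = _
    rw [mul_inv_eq_iff_eq_mul₀ (W.complexVelocity_ne_zero (hzD t))]
    apply Complex.ext <;> simp [complexVelocity, energy, pow_two] <;> ring
  refine ⟨fun t => ((z t).1 + W.c * t, (z t).2), fun t => ?_, ?_⟩
  · have h3 : HasDerivAt (fun t => (z t).1) (W.u (z t) - W.c) t := by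
      have := Complex.reCLM.hasFDerivAt.comp_hasDerivAt t (hzd t)
      simpa [Function.comp_def] using this
    have h4 : HasDerivAt (fun t => (z t).2) (W.v (z t)) t := by
      have := Complex.imCLM.hasFDerivAt.comp_hasDerivAt t (hzd t)
      simpa [Function.comp_def] using this
    have h5 := (h3.add ((hasDerivAt_id t).const_mul W.c)).prodMk h4
    rw [mul_one, sub_add_cancel] at h5
    simp only [add_sub_cancel_right, Prod.mk.eta]
    exact ⟨hzD t, h5⟩
  · have h6 : z t₀ = z₀ := by
      simp only [hz, hq, sub_self, add_zero, hστ]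
      exact hodographInv_hodograph hψ hφ h₀
    simp [h6, hz₀]

/-- A shift by -L on the streamline is a shift by cL in q, that is, an advance of the clock by its
full period; strict monotonicity of the clock gives uniqueness. -/
theorem IsParticlePath.period_iff {X : ℝ → ℝ × ℝ} (hX : W.IsParticlePath X)
    (hψ : W.IsStreamFunction ψ) (hφ : W.IsVelocityPotential φ ψ) {p t₀ : ℝ}
    (hp : ψ (W.movingFrame X t₀) = p) (s : ℝ) :
    (X (s + t₀)).1 - W.c * s = (X t₀).1 - W.L ↔ s = W.passageTime φ ψ p (W.c * W.L) := by
  set z := W.movingFrame X with hz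
  have hp0 : 0 < p := hp ▸ hψ.pos (hX t₀).1
  have hmem₀ : ((z t₀).1, (z t₀).2) ∈ W.domain := (hX t₀).1
  have hmem : ((z t₀).1 - W.L, (z t₀).2) ∈ W.domain := by
    rw [← mem_domain_add_period, sub_add_cancel]
    exact hmem₀
  have h1 := hφ.add_period hψ hmem
  have h2 := hψ.periodic hmem
  rw [sub_add_cancel, Prod.mk.eta] at h1 h2
  rw [hp] at h2
  have h3 : (X (s + t₀)).1 - W.c * s = (X t₀).1 - W.L ↔ (z (s + t₀)).1 = (z t₀).1 - W.L := by
    simp only [hz, movingFrame]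
    constructor <;> intro h <;> linarith
  have h4 := hX.passageTime_eq hψ hφ hp (s + t₀)
  have h5 := passageTime_add_period hψ hφ hp0 (φ (z t₀))
  have h6 : ψ (z (s + t₀)) = p := (hX.streamFunction_eq hψ _ t₀).trans hp
  -- On a single streamline the abscissa determines the point.
  have hlev : (z (s + t₀)).1 = (z t₀).1 - W.L ↔ z (s + t₀) = ((z t₀).1 - W.L, (z t₀).2) := by
    constructor
    · intro h
      refine Prod.ext h ?_
      have h7 : W.level ψ (ψ (z (s + t₀))) (z (s + t₀)).1 = (z (s + t₀)).2 :=
        hψ.level_apply (hX (s + t₀)).1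
      have h8 := hψ.level_apply hmem
      rw [← h2] at h8
      rw [h6, h, h8] at h7
      exact h7.symm
    · intro h
      rw [h]
  rw [h3, hlev]
  have h9 : φ ((z t₀).1 - W.L, (z t₀).2) = φ (z t₀) + W.c * W.L := by linarith
  constructor
  · intro h
    rw [← hz, h, h9, h5] at h4
    linarith
  · intro h
    refine (hodograph_bijOn hψ hφ).injOn (hX _).1 hmem (Complex.ext ?_ (h6.trans h2))
    refine (strictMono_passageTime hψ hφ hp0).injective ?_
    simp only [hodograph]
    rw [h9, h5]
    rw [add_sub_cancel_right] at h4
    exact h4.trans (congrArg (_ + ·) h)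

theorem norm_reflectedVelocity_sq_of_neg {w : ℂ} (hw : w.im < 0) :
    ‖W.reflectedVelocity φ ψ w‖ ^ 2 = 2 * W.energy (W.hodographInv φ ψ (starRingEnd ℂ w)) := by
  rw [reflectedVelocity, if_neg hw.not_gt, RCLike.norm_conj, norm_complexVelocity_sq]

theorem norm_reflectedVelocity_sq_of_pos {w : ℂ} (hw : 0 < w.im) :
    ‖W.reflectedVelocity φ ψ w‖ ^ 2 = 2 * W.energy (W.hodographInv φ ψ w) := by
  rw [reflectedVelocity, if_pos hw, norm_complexVelocity_sq]

end StokesWave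

end

/-! ### The streamline time-period. -/

theorem theorem4p1 (W : StokesWave) :
    -- the stream function and the velocity potential exist
    (∃ φ ψ : ℝ × ℝ → ℝ, W.IsStreamFunction ψ ∧ W.IsVelocityPotential φ ψ) ∧
    -- particle paths are globally and uniquely determined by their initial data
    (∀ t₀ x₀ y₀ : ℝ, (x₀ - W.c * t₀, y₀) ∈ W.domain →
      ∃! X : ℝ → ℝ × ℝ, W.IsParticlePath X ∧ X t₀ = (x₀, y₀)) ∧
    ∀ φ ψ : ℝ × ℝ → ℝ, W.IsStreamFunction ψ → W.IsVelocityPotential φ ψ →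
      Set.BijOn (StokesWave.hodograph φ ψ) W.domain {w : ℂ | 0 < w.im} ∧
      ∃ T : ℝ → ℝ,
        -- `T p` is positive and is the unique solution for every particle on the streamline `p`
        (∀ p : ℝ, 0 < p → 0 < T p ∧
          ∀ (t₀ x₀ y₀ : ℝ), (x₀ - W.c * t₀, y₀) ∈ W.domain → ψ (x₀ - W.c * t₀, y₀) = p →
          ∀ X : ℝ → ℝ × ℝ, W.IsParticlePath X → X t₀ = (x₀, y₀) →
          ∀ τ : ℝ, (X (τ + t₀)).1 - W.c * τ = x₀ - W.L ↔ τ = T p) ∧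
        (∀ p : ℝ, 0 < p →
          T p = ∫ q in (0 : ℝ)..(W.c * W.L), 1 / (2 * W.energy (W.hodographInv φ ψ ⟨q, p⟩))) ∧
        (∀ p : ℝ, 0 < p → T p = W.c * W.L / 2 * W.energyMean φ ψ (-1) p) ∧
        ConvexOn ℝ (Set.Ioi 0) T ∧
        AntitoneOn T (Set.Ioi 0) ∧
        ConvexOn ℝ (Set.Ioi 0) (fun p => Real.log (T p)) ∧
        -- for negative `p` the formula is read with the reflected complex velocity; `T` is even
        (∀ p : ℝ, p ≠ 0 →
          T p = ∫ q in (0 : ℝ)..(W.c * W.L), 1 / ‖W.reflectedVelocity φ ψ ⟨q, p⟩‖ ^ 2) ∧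
        Function.Even T := by
  refine ⟨W.exists_isStreamFunction_isVelocityPotential, fun t₀ x₀ y₀ h₀ => ?_,
    fun φ ψ hψ hφ => ⟨StokesWave.hodograph_bijOn hψ hφ, ?_⟩⟩
  · obtain ⟨φ, ψ, hψ, hφ⟩ := W.exists_isStreamFunction_isVelocityPotential
    obtain ⟨X, hX, hX₀⟩ := StokesWave.exists_isParticlePath hψ hφ h₀
    exact ⟨X, ⟨hX, hX₀⟩, fun X' h => h.1.ext hX hψ hφ (h.2.trans hX₀.symm)⟩
  obtain ⟨a, ha, hsum⟩ := StokesWave.exists_hasSum_exp_passageTime hψ hφ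
  have hT : ∀ p : ℝ, 0 < p → HasSum
      (fun n : ℕ => a n * Real.exp (-(4 * Real.pi * n / (W.c * W.L)) * p))
      (W.passageTime φ ψ |p| (W.c * W.L)) := fun p hp => by
    rw [abs_of_pos hp]
    exact hsum p hp
  have hb : ∀ n : ℕ, 0 ≤ 4 * Real.pi * n / (W.c * W.L) := fun n => by
    have := W.c_pos
    have := W.L_pos
    positivity
  -- Taking |p| builds in evenness. At p = 0 the value rests on the default of `Function.invFunOn`
  -- outside the image of h; only evenness concerns it.
  refine ⟨fun p => W.passageTime φ ψ |p| (W.c * W.L), ?_, ?_, ?_, ?_, ?_, ?_, ?_, ?_⟩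
  · intro p hp
    simp only [abs_of_pos hp]
    refine ⟨StokesWave.passageTime_period_pos hψ hφ hp, fun t₀ x₀ y₀ _ hp₀ X hX hX₀ τ => ?_⟩
    have h := hX.period_iff hψ hφ (p := p) (t₀ := t₀)
      (by simpa only [StokesWave.movingFrame, hX₀] using hp₀) τ
    rwa [hX₀] at h
  · intro p hp
    simp only [abs_of_pos hp]
    rfl
  · intro p hp
    simp only [abs_of_pos hp, StokesWave.passageTime, StokesWave.energyMean, Real.rpow_neg_one,
      one_div, mul_inv, intervalIntegral.integral_const_mul]
    have hc := W.c_pos.ne'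
    have hL := W.L_pos.ne'
    field_simp
  · exact convexOn_of_hasSum_exp ha hT
  · exact antitoneOn_of_hasSum_exp ha hb hT
  · refine convexOn_log_of_hasSum_exp ha hT fun p hp => ?_
    rw [abs_of_pos hp]
    exact StokesWave.passageTime_period_pos hψ hφ hp
  · intro p hp
    rcases hp.lt_or_gt with h | h
    · simp only [abs_of_neg h, StokesWave.passageTime]
      refine intervalIntegral.integral_congr fun q _ => ?_
      rw [StokesWave.norm_reflectedVelocity_sq_of_neg h]
      rfl
    · simp only [abs_of_pos h, StokesWave.passageTime]
      refine intervalIntegral.integral_congr fun q _ => ?_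
      rw [StokesWave.norm_reflectedVelocity_sq_of_pos h]
  · intro p
    simp only [abs_neg]
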